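/- Let $K$ be an algebraically closed field, let $n\ge 1$ be an integer, let $q,Q\in K^\times$, and fix square roots $\sqrt q,\sqrt Q\in K$. Put $$\delta_L=\delta_R=\frac{1+Q}{\sqrt Q},\qquad \delta=\frac{1+q}{\sqrt q},\qquad \kappa_L=\kappa_R=\frac{q+Q}{\sqrt q\,\sqrt Q}.$$ Let $W(\tilde C_n)$ be the Coxeter group with generators $\sigma_0,\dots,\sigma_n$ whose Coxeter graph is the path $0-1-\cdots-n$, where the edges $\{0,1\}$ and $\{n-1,n\}$ are labelled $4$ and all other edges are labelled $3$ (for $n=1$: the Coxeter group of type $B_2$). An element $w$ is fully commutative if any reduced expression of $w$ can be obtained from any other by commutation relations $\sigma_i\sigma_j=\sigma_j\sigma_i$ ($|i-j|>1$) only. An element $w$ contains $u$ if some reduced expression of $u$ is a subword of consecutive letters of some reduced expression of $w$; otherwise $w$ avoids $u$. A fully commutative element is positive if it avoids both $\sigma_1\sigma_0\sigma_1$ and $\sigma_{n-1}\sigma_n\sigma_{n-1}$; let $W^{+c+}(\tilde C_n)$ be the set of positive fully commutative elements. Let $TL\tilde C_n(q,Q)$ be the associative unital $K$-algebra with generators $U_0,\dots,U_n$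 and relations - $U_0^2=\delta_LU_0$, $U_n^2=\delta_RU_n$, and $U_i^2=\delta U_i$ for $0<i<n$; - $U_iU_j=U_jU_i$ for $|i-j|>1$; - $U_iU_jU_i=U_i$ for $|i-j|=1$ and $0<i,j<n$; - $U_iU_jU_iU_j=\kappa_LU_iU_j$ for $\{i,j\}=\{0,1\}$, and $U_iU_jU_iU_j=\kappa_RU_iU_j$ for $\{i,j\}=\{n-1,n\}$. Let $2BTL_n(q,Q)$ be the algebra with the same generators and relations together with $U_1U_0U_1=\kappa_LU_1$ and $U_{n-1}U_nU_{n-1}=\kappa_RU_{n-1}$; it is a quotient of $TL\tilde C_n(q,Q)$. For a fully commutative $w$ with reduced expression $w=\sigma_{i_1}\cdots\sigma_{i_r}$, put $b_w=U_{i_1}\cdots U_{i_r}\in TL\tilde C_n(q,Q)$. **Theorem.** The element $b_w$ does not depend on the choice of the reduced expression of the fully commutative element $w$, and the images of the elements $b_w$, $w\in W^{+c+}(\tilde C_n)$, in $2BTL_n(q,Q)$ form a $K$-basis of $2BTL_n(q,Q)$ (indexed by $W^{+c+}(\tilde C_n)$, that is, distinct $w$ give distinct basis elements). -/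

import Mathlib

namespace TwoBoundary

/-- The Coxeter matrix of type `C̃ₙ` on the vertices `0, 1, …, n`: a path whose first edge `{0, 1}`
and last edge `{n - 1, n}` are labelled `4` and whose other edges are labelled `3`.
For `n = 1` this is the Coxeter matrix of type `B₂`. -/
def affineC (n : ℕ) : CoxeterMatrix (Fin (n + 1)) where
  M := Matrix.of fun i j =>
    if i = j then 1
    else if i.val + 1 = j.val ∨ j.val + 1 = i.val then
      (if i.val = 0 ∨ j.val = 0 ∨ i.val = n ∨ j.val = n then 4 else 3)
    else 2
  isSymm := by
    ext i j
    simp only [Matrix.transpose_apply, Matrix.of_apply]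
    split_ifs <;> first | rfl | omega
  diagonal := by intro i; simp
  off_diagonal := by
    intro i j hij
    simp only [Matrix.of_apply, if_neg hij]
    split_ifs <;> omega

/-- The Coxeter group `W(C̃ₙ)`. -/
abbrev W (n : ℕ) : Type := (affineC n).Group

/-- The Coxeter system `(W(C̃ₙ), {σ₀, …, σₙ})`. -/
abbrev cs (n : ℕ) : CoxeterSystem (affineC n) (W n) := (affineC n).toCoxeterSystem

/-- The vertex `i`, meant for `0 ≤ i ≤ n`. -/
abbrev vtx (n i : ℕ) : Fin (n + 1) := Fin.ofNat (n + 1) i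

/-- `ω` is a reduced expression of `w`. -/
def IsReducedExpr {n : ℕ} (w : W n) (ω : List (Fin (n + 1))) : Prop :=
  (cs n).IsReduced ω ∧ (cs n).wordProd ω = w

/-- One application of a commutation relation `σₛ σₜ = σₜ σₛ` (where `m(s, t) = 2`) to a word. -/
inductive CommStep (n : ℕ) : List (Fin (n + 1)) → List (Fin (n + 1)) → Prop
  | swap (α β : List (Fin (n + 1))) (s t : Fin (n + 1)) (h : affineC n s t = 2) :
      CommStep n (α ++ [s, t] ++ β) (α ++ [t, s] ++ β)

/-- `w` is fully commutative: one passes from any reduced expression to any other by commutation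
relations only. -/
def IsFullyCommutative {n : ℕ} (w : W n) : Prop :=
  ∀ ω ω' : List (Fin (n + 1)), IsReducedExpr w ω → IsReducedExpr w ω' →
    Relation.ReflTransGen (CommStep n) ω ω'

/-- `w` contains `u`: some reduced expression of `u` is a contiguous subword of some reduced
expression of `w`. -/
def Contains {n : ℕ} (w u : W n) : Prop :=
  ∃ ω υ : List (Fin (n + 1)), IsReducedExpr w ω ∧ IsReducedExpr u υ ∧ υ <:+: ω

/-- `w` avoids `u`. -/
def Avoids {n : ℕ} (w u : W n) : Prop := ¬ Contains w u

/-- The Coxeter generator `σᵢ`, for `0 ≤ i ≤ n`. -/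
def σ (n i : ℕ) : W n := (cs n).simple (vtx n i)

/-- `Wᶜ(C̃ₙ)`: the fully commutative elements. -/
def fullyCommutative (n : ℕ) : Set (W n) := {w | IsFullyCommutative w}

/-- `W⁺ᶜ(C̃ₙ)`: the left-positive elements. -/
def leftPositive (n : ℕ) : Set (W n) :=
  {w | w ∈ fullyCommutative n ∧ Avoids w (σ n 1 * σ n 0 * σ n 1)}

/-- `Wᶜ⁺(C̃ₙ)`: the right-positive elements. -/
def rightPositive (n : ℕ) : Set (W n) :=
  {w | w ∈ fullyCommutative n ∧ Avoids w (σ n (n - 1) * σ n n * σ n (n - 1))}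

/-- `W⁺ᶜ⁺(C̃ₙ)`: the positive fully commutative elements. -/
def positive (n : ℕ) : Set (W n) := leftPositive n ∩ rightPositive n

/-- The five parameters of the algebras. -/
structure Params (K : Type*) where
  δ : K
  δL : K
  δR : K
  κL : K
  κR : K

/-- The specialization `δL = δR = (1 + Q)/√Q`, `δ = (1 + q)/√q`, `κL = κR = (q + Q)/(√q √Q)`, where
`rq` and `rQ` are the chosen square roots of `q` and `Q`. -/
def Params.special {K : Type*} [Field K] (q Q rq rQ : K) : Params K where
  δ := (1 + q) / rq
  δL := (1 + Q) / rQ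
  δR := (1 + Q) / rQ
  κL := (q + Q) / (rq * rQ)
  κR := (q + Q) / (rq * rQ)

section Algebras

variable {K : Type*} [Field K]

/-- The free generator `uᵢ`. -/
abbrev u (K : Type*) [Field K] {n : ℕ} (i : Fin (n + 1)) : FreeAlgebra K (Fin (n + 1)) :=
  FreeAlgebra.ι K i

/-- The defining relations of the Temperley–Lieb algebra of type `C̃ₙ` in the generators
`U₀, …, Uₙ`. -/
inductive TLRel (n : ℕ) (p : Params K) :
    FreeAlgebra K (Fin (n + 1)) → FreeAlgebra K (Fin (n + 1)) → Prop
  | sq_left (i : Fin (n + 1)) (h : i.val = 0) :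
      TLRel n p (u K i * u K i) (p.δL • u K i)
  | sq_right (i : Fin (n + 1)) (h : i.val = n) :
      TLRel n p (u K i * u K i) (p.δR • u K i)
  | sq_mid (i : Fin (n + 1)) (h₀ : 0 < i.val) (hn : i.val < n) :
      TLRel n p (u K i * u K i) (p.δ • u K i)
  | comm (i j : Fin (n + 1)) (h : i.val + 1 < j.val ∨ j.val + 1 < i.val) :
      TLRel n p (u K i * u K j) (u K j * u K i)
  | cubic (i j : Fin (n + 1)) (h : i.val + 1 = j.val ∨ j.val + 1 = i.val)
      (hi₀ : 0 < i.val) (hin : i.val < n) (hj₀ : 0 < j.val) (hjn : j.val < n) :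
      TLRel n p (u K i * u K j * u K i) (u K i)
  | quartic_left (i j : Fin (n + 1))
      (h : (i.val = 0 ∧ j.val = 1) ∨ (i.val = 1 ∧ j.val = 0)) :
      TLRel n p (u K i * u K j * u K i * u K j) (p.κL • (u K i * u K j))
  | quartic_right (i j : Fin (n + 1))
      (h : (i.val + 1 = n ∧ j.val = n) ∨ (i.val = n ∧ j.val + 1 = n)) :
      TLRel n p (u K i * u K j * u K i * u K j) (p.κR • (u K i * u K j))

/-- The defining relations of the two-boundary Temperley–Lieb algebra: those of the Temperley–Lieb
algebra of type `C̃ₙ` together with `U₁U₀U₁ = κL U₁` and `Uₙ₋₁UₙUₙ₋₁ = κR Uₙ₋₁`. -/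
inductive TwoBTLRel (n : ℕ) (p : Params K) :
    FreeAlgebra K (Fin (n + 1)) → FreeAlgebra K (Fin (n + 1)) → Prop
  | tl {a b : FreeAlgebra K (Fin (n + 1))} (h : TLRel n p a b) : TwoBTLRel n p a b
  | left (i j : Fin (n + 1)) (hi : i.val = 1) (hj : j.val = 0) :
      TwoBTLRel n p (u K i * u K j * u K i) (p.κL • u K i)
  | right (i j : Fin (n + 1)) (hi : i.val + 1 = n) (hj : j.val = n) :
      TwoBTLRel n p (u K i * u K j * u K i) (p.κR • u K i)

/-- The Temperley–Lieb algebra of type `C̃ₙ`. -/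
abbrev TLC (n : ℕ) (p : Params K) : Type _ := RingQuot (TLRel n p)

/-- The two-boundary Temperley–Lieb algebra. -/
abbrev TwoBTL (n : ℕ) (p : Params K) : Type _ := RingQuot (TwoBTLRel n p)

/-- The generator `Uᵢ` of the Temperley–Lieb algebra of type `C̃ₙ`. -/
def U (n : ℕ) (p : Params K) (i : Fin (n + 1)) : TLC n p :=
  RingQuot.mkAlgHom K (TLRel n p) (u K i)

/-- The canonical surjection from the Temperley–Lieb algebra of type `C̃ₙ` to the two-boundary
Temperley–Lieb algebra, sending generators to generators. -/
def proj (n : ℕ) (p : Params K) : TLC n p →ₐ[K] TwoBTL n p :=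
  RingQuot.liftAlgHom K
    ⟨RingQuot.mkAlgHom K (TwoBTLRel n p), fun _ _ h => RingQuot.mkAlgHom_rel K (TwoBTLRel.tl h)⟩

/-- The product `U_{i₁} ⋯ U_{iᵣ}` attached to a word. -/
def monomial (n : ℕ) (p : Params K) (ω : List (Fin (n + 1))) : TLC n p :=
  (ω.map (U n p)).prod

theorem exists_reducedExpr {n : ℕ} (w : W n) : ∃ ω, IsReducedExpr w ω := by
  obtain ⟨ω, h, h'⟩ := (cs n).exists_isReduced w
  exact ⟨ω, h, h'.symm⟩

/-- `b_w = U_{i₁} ⋯ U_{iᵣ}` for a chosen reduced expression `w = σ_{i₁} ⋯ σ_{iᵣ}`. -/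
noncomputable def b (n : ℕ) (p : Params K) (w : W n) : TLC n p :=
  monomial n p (exists_reducedExpr w).choose

end Algebras

end TwoBoundary

/-! The defining relations are read as rewriting rules on words modulo commutation: `i i → i` and `i
j i → i` for adjacent `i`, `j`, with `i` interior or `n = 1`, each with a scalar. The quartic
relations are consequences of these. Every rule shortens the word, so irreducible words span. Two
facts remain.

Irreducible words are linearly independent. Any two one-step reductions of the same trace agree
after further reduction (`RespectsRules.join`), so the normal form does not depend on the rules
applied. Hence letting `Uₓ` send a trace `m` to the normal form of `x m` defines a representation on
the span of all traces (`traceRep`). A word applied to the empty trace gives its normal form, so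
distinct irreducible traces give distinct basis vectors.

Irreducible traces are exactly the commutation classes of reduced words of positive elements. A
positive element has no reducible reduced word: `i i` is not reduced, a boundary factor `i j i` is
excluded by positivity, and an interior one admits a braid move, which changes the letter count. For
the converse, at `q = Q = 1` over `ℚ` the map `σᵢ ↦ 1 - Uᵢ` is a homomorphism from the Coxeter
group. Applied to the empty trace, a word gives, up to sign, its normal form plus shorter terms. The
group element therefore remembers an irreducible word as its leading term, so this word is reduced
and is the only reduced expression up to commutations (`length_le_and_mk_eq`). -/

namespace TwoBoundary

/-! ### The trace monoid of words modulo commutation -/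

section Trace

variable {n : ℕ}

/-- The vertices `x` and `y` are at distance at least two on the path `0 - 1 - ⋯ - n`. -/
abbrev Far (x y : Fin (n + 1)) : Prop := x.val + 1 < y.val ∨ y.val + 1 < x.val

/-- The vertices `x` and `y` are adjacent on the path `0 - 1 - ⋯ - n`. -/
abbrev Near (x y : Fin (n + 1)) : Prop := x.val + 1 = y.val ∨ y.val + 1 = x.val

theorem affineC_apply (i j : Fin (n + 1)) : affineC n i j =
    if i = j then 1
    else if i.val + 1 = j.val ∨ j.val + 1 = i.val then
      (if i.val = 0 ∨ j.val = 0 ∨ i.val = n ∨ j.val = n then 4 else 3)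
    else 2 := rfl

theorem affineC_eq_two_iff {x y : Fin (n + 1)} : affineC n x y = 2 ↔ Far x y := by
  rw [affineC_apply]
  simp only [Fin.ext_iff]
  split_ifs <;> omega

theorem CommStep.symm {ω ω' : List (Fin (n + 1))} (h : CommStep n ω ω') : CommStep n ω' ω := by
  obtain ⟨α, β, s, t, h⟩ := h
  exact .swap α β t s (by rw [affineC_eq_two_iff] at *; omega)

theorem CommStep.append_left {ω ω' : List (Fin (n + 1))} (h : CommStep n ω ω')
    (γ : List (Fin (n + 1))) : CommStep n (γ ++ ω) (γ ++ ω') := by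
  obtain ⟨α, β, s, t, h⟩ := h
  simpa using CommStep.swap (γ ++ α) β s t h

theorem CommStep.append_right {ω ω' : List (Fin (n + 1))} (h : CommStep n ω ω')
    (γ : List (Fin (n + 1))) : CommStep n (ω ++ γ) (ω' ++ γ) := by
  obtain ⟨α, β, s, t, h⟩ := h
  simpa using CommStep.swap α (β ++ γ) s t h

theorem CommStep.perm {ω ω' : List (Fin (n + 1))} (h : CommStep n ω ω') : ω.Perm ω' := by
  obtain ⟨α, β, s, t, -⟩ := h
  exact ((List.Perm.swap t s []).append_left α).append_right β

/-- Equivalence of words under commutation relations. -/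
def commSetoid (n : ℕ) : Setoid (List (Fin (n + 1))) where
  r := Relation.ReflTransGen (CommStep n)
  iseqv :=
    ⟨fun _ => .refl, fun h => by
      induction h with
      | refl => exact .refl
      | tail _ h₂ ih => exact .head h₂.symm ih,
      fun h h' => Relation.ReflTransGen.trans h h'⟩

theorem commEquiv_append {a a' b b' : List (Fin (n + 1))}
    (h : Relation.ReflTransGen (CommStep n) a a') (hb : Relation.ReflTransGen (CommStep n) b b') :
    Relation.ReflTransGen (CommStep n) (a ++ b) (a' ++ b') :=
  Relation.ReflTransGen.trans
    (Relation.ReflTransGen.lift (r := CommStep n) (p := CommStep n) (· ++ b)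
      (fun _ _ s => s.append_right b) a a' h)
    (Relation.ReflTransGen.lift (r := CommStep n) (p := CommStep n) (a' ++ ·)
      (fun _ _ s => s.append_left a') b b' hb)

/-- Words modulo commutation relations. -/
def Trace (n : ℕ) : Type := Quotient (commSetoid n)

namespace Trace

/-- The commutation class of a word. -/
def mk (ω : List (Fin (n + 1))) : Trace n := Quotient.mk (commSetoid n) ω

theorem mk_eq_mk {ω ω' : List (Fin (n + 1))} :
    mk ω = mk ω' ↔ Relation.ReflTransGen (CommStep n) ω ω' :=
  Quotient.eq (r := commSetoid n)

theorem mk_surjective : Function.Surjective (mk : List (Fin (n + 1)) → Trace n) :=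
  Quotient.mk_surjective

theorem mk_eq_of_step {ω ω' : List (Fin (n + 1))} (h : CommStep n ω ω') : mk ω = mk ω' :=
  mk_eq_mk.2 (.single h)

/-- A function on words that is invariant under a single commutation descends to traces. -/
def lift {β : Type*} (f : List (Fin (n + 1)) → β)
    (h : ∀ ω ω', CommStep n ω ω' → f ω = f ω') : Trace n → β :=
  Quotient.lift f fun a b hab => by
    replace hab : Relation.ReflTransGen (CommStep n) a b := hab
    induction hab with
    | refl => rfl
    | tail _ h₂ ih => rw [ih, h _ _ h₂]

@[simp]
theorem lift_mk {β : Type*} (f : List (Fin (n + 1)) → β)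
    (h : ∀ ω ω', CommStep n ω ω' → f ω = f ω') (ω : List (Fin (n + 1))) :
    lift f h (mk ω) = f ω := rfl

instance : Monoid (Trace n) where
  mul := Quotient.map₂ (· ++ ·) fun _ _ h _ _ h' => commEquiv_append h h'
  one := mk []
  mul_assoc a b c := by
    obtain ⟨a, rfl⟩ := mk_surjective a
    obtain ⟨b, rfl⟩ := mk_surjective b
    obtain ⟨c, rfl⟩ := mk_surjective c
    exact congrArg mk (List.append_assoc a b c)
  one_mul a := by
    obtain ⟨a, rfl⟩ := mk_surjective a
    exact congrArg mk (List.nil_append a)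
  mul_one a := by
    obtain ⟨a, rfl⟩ := mk_surjective a
    exact congrArg mk (List.append_nil a)

theorem mk_append (ω ω' : List (Fin (n + 1))) : mk (ω ++ ω') = mk ω * mk ω' := rfl

@[simp]
theorem mk_nil : mk ([] : List (Fin (n + 1))) = 1 := rfl

/-- The trace of a single letter. -/
def g (x : Fin (n + 1)) : Trace n := mk [x]

theorem mk_cons (x : Fin (n + 1)) (ω : List (Fin (n + 1))) : mk (x :: ω) = g x * mk ω := rfl

@[elab_as_elim]
theorem induction_left {P : Trace n → Prop} (one : P 1) (mul : ∀ x a, P a → P (g x * a))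
    (a : Trace n) : P a := by
  obtain ⟨ω, rfl⟩ := mk_surjective a
  induction ω with
  | nil => exact one
  | cons x ω ih => exact mul x _ ih

theorem g_comm {x y : Fin (n + 1)} (h : Far x y) : g x * g y = g y * g x :=
  mk_eq_of_step (CommStep.swap [] [] x y (affineC_eq_two_iff.2 h))

/-- The multiset of letters of a trace. -/
def letters : Trace n → Multiset (Fin (n + 1)) :=
  lift (fun ω => (ω : Multiset (Fin (n + 1)))) fun _ _ h => Multiset.coe_eq_coe.2 h.perm

@[simp]
theorem letters_mk (ω : List (Fin (n + 1))) : letters (mk ω) = ω := rfl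

@[simp]
theorem letters_one : letters (1 : Trace n) = 0 := rfl

@[simp]
theorem letters_g (x : Fin (n + 1)) : letters (g x) = {x} := rfl

@[simp]
theorem letters_mul (a b : Trace n) : letters (a * b) = letters a + letters b := by
  obtain ⟨a, rfl⟩ := mk_surjective a
  obtain ⟨b, rfl⟩ := mk_surjective b
  rw [← mk_append]
  simp

/-- The number of letters of a trace. -/
def len (a : Trace n) : ℕ := (letters a).card

@[simp]
theorem len_mk (ω : List (Fin (n + 1))) : len (mk ω) = ω.length := rfl

@[simp]
theorem len_one : len (1 : Trace n) = 0 := rfl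

@[simp]
theorem len_g (x : Fin (n + 1)) : len (g x) = 1 := rfl

@[simp]
theorem len_mul (a b : Trace n) : len (a * b) = len a + len b := by simp [len]

/-- Every letter of `a` is at distance at least two from `x`. -/
def Indep (x : Fin (n + 1)) (a : Trace n) : Prop := ∀ y ∈ letters a, Far x y

@[simp]
theorem indep_one (x : Fin (n + 1)) : Indep x 1 := by simp [Indep]

@[simp]
theorem indep_g {x y : Fin (n + 1)} : Indep x (g y) ↔ Far x y := by simp [Indep]

@[simp]
theorem indep_mul {x : Fin (n + 1)} {a b : Trace n} :
    Indep x (a * b) ↔ Indep x a ∧ Indep x b := by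
  simp only [Indep, letters_mul, Multiset.mem_add, or_imp, forall_and]

theorem Indep.comm {x : Fin (n + 1)} {a : Trace n} (h : Indep x a) : g x * a = a * g x := by
  induction a using induction_left with
  | one => simp
  | mul y a ih =>
    rw [indep_mul, indep_g] at h
    rw [← mul_assoc, g_comm h.1, mul_assoc, ih h.2, mul_assoc]

theorem Indep.comm_mul {x : Fin (n + 1)} {a : Trace n} (h : Indep x a) (b : Trace n) :
    a * (g x * b) = g x * (a * b) := by
  rw [← mul_assoc, ← h.comm, mul_assoc]

/-- Remove the first `x` of a word if all the letters before it are far from `x`. -/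
def eraseMin (x : Fin (n + 1)) : List (Fin (n + 1)) → Option (List (Fin (n + 1)))
  | [] => none
  | y :: ω => if y = x then some ω else if Far x y then (eraseMin x ω).map (y :: ·) else none

/-- The remaining word depends on the representative, but its commutation class does not; this makes
left division well defined on traces. -/
theorem eraseMin_map_mk_of_step (x : Fin (n + 1)) {ω ω' : List (Fin (n + 1))}
    (h : CommStep n ω ω') : (eraseMin x ω).map mk = (eraseMin x ω').map mk := by
  obtain ⟨α, β, s, t, h⟩ := h
  have h' := affineC_eq_two_iff.1 h
  induction α with
  | nil =>
    simp only [List.nil_append, List.cons_append, eraseMin]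
    by_cases hs : s = x
    · subst hs
      have : t ≠ s := by rintro rfl; omega
      simp [this, h']
    · by_cases ht : t = x
      · subst ht
        have : Far t s := h'.symm
        simp [hs, this]
      · by_cases hs' : Far x s
        · by_cases ht' : Far x t
          · simp only [if_neg hs, if_neg ht, if_pos hs', if_pos ht', Option.map_map]
            congr 1
            funext γ
            exact mk_eq_of_step (CommStep.swap [] γ s t h)
          · simp [hs, ht, hs', ht']
        · by_cases ht' : Far x t <;> simp [hs, ht, hs', ht']
  | cons y α ih =>
    simp only [List.cons_append, eraseMin]
    split_ifs
    · exact congrArg some (mk_eq_of_step (by simpa using CommStep.swap α β s t h))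
    · have : (mk ∘ (y :: ·) : List (Fin (n + 1)) → Trace n) = (g y * ·) ∘ mk := rfl
      rw [Option.map_map, Option.map_map, this, ← Option.map_map, ih, Option.map_map]
    · rfl

/-- Left division of a trace by the letter `x`. -/
def leftDiv (x : Fin (n + 1)) : Trace n → Option (Trace n) :=
  lift (fun ω => (eraseMin x ω).map mk) fun _ _ h => eraseMin_map_mk_of_step x h

theorem leftDiv_one (x : Fin (n + 1)) : leftDiv x 1 = none := rfl

theorem leftDiv_g_mul (x y : Fin (n + 1)) (a : Trace n) : leftDiv x (g y * a) =
    if y = x then some a else if Far x y then (leftDiv x a).map (g y * ·) else none := by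
  obtain ⟨ω, rfl⟩ := mk_surjective a
  rw [← mk_cons]
  simp only [leftDiv, lift_mk, eraseMin]
  split_ifs
  · rfl
  · rw [Option.map_map, Option.map_map]
    rfl
  · rfl

/-- Left division by `x` inverts left multiplication by `x`. -/
theorem g_mul_cancel {x : Fin (n + 1)} {a b : Trace n} (h : g x * a = g x * b) : a = b := by
  have := congrArg (leftDiv x) h
  simpa [leftDiv_g_mul] using this

@[simp]
theorem g_mul_inj {x : Fin (n + 1)} {a b : Trace n} : g x * a = g x * b ↔ a = b :=
  ⟨g_mul_cancel, fun h => by rw [h]⟩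

theorem exists_of_leftDiv_mul {x : Fin (n + 1)} {a b : Trace n}
    (h : (leftDiv x (a * b)).isSome) :
    (∃ a', a = g x * a') ∨ (Indep x a ∧ ∃ b', b = g x * b') := by
  induction a using induction_left with
  | one =>
    right
    refine ⟨indep_one x, ?_⟩
    rw [one_mul] at h
    induction b using induction_left with
    | one => simp [leftDiv_one] at h
    | mul y b ih =>
      rw [leftDiv_g_mul] at h
      split_ifs at h with h₁ h₂
      · exact ⟨b, by rw [h₁]⟩
      · obtain ⟨b', rfl⟩ := ih (by simpa using h)
        exact ⟨g y * b', by rw [← mul_assoc, ← mul_assoc, g_comm h₂]⟩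
      · simp at h
  | mul y a ih =>
    rw [mul_assoc, leftDiv_g_mul] at h
    split_ifs at h with h₁ h₂
    · exact .inl ⟨a, by rw [h₁]⟩
    · rcases ih (by simpa using h) with ⟨a', rfl⟩ | ⟨ha, hb⟩
      · exact .inl ⟨g y * a', by rw [← mul_assoc, ← mul_assoc, g_comm h₂]⟩
      · exact .inr ⟨by simp [ha, h₂], hb⟩
    · simp at h

/-- A letter that can be moved to the front of `a * b` comes either from `a`, or from `b` through
`a`. -/
theorem levi {x : Fin (n + 1)} {a b c : Trace n} (h : g x * c = a * b) :
    (∃ a', a = g x * a' ∧ c = a' * b) ∨ (Indep x a ∧ ∃ b', b = g x * b' ∧ c = a * b') := by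
  have : (leftDiv x (a * b)).isSome := by rw [← h, leftDiv_g_mul]; simp
  rcases exists_of_leftDiv_mul this with ⟨a', rfl⟩ | ⟨ha, b', rfl⟩
  · exact .inl ⟨a', rfl, g_mul_cancel (x := x) (by simpa [mul_assoc] using h)⟩
  · exact .inr ⟨ha, b', rfl, g_mul_cancel (by rw [h, ha.comm_mul])⟩

theorem levi_g {x y : Fin (n + 1)} {b c : Trace n} (h : g x * c = g y * b) :
    (x = y ∧ c = b) ∨ (Far x y ∧ ∃ b', b = g x * b' ∧ c = g y * b') := by
  have := congrArg (leftDiv x) h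
  rw [leftDiv_g_mul, leftDiv_g_mul, if_pos rfl] at this
  by_cases hxy : y = x
  · subst hxy
    exact .inl ⟨rfl, by simpa using this⟩
  · rcases levi h with ⟨a', ha, rfl⟩ | ⟨ha, hb⟩
    · have := congrArg letters ha
      simp only [letters_g, letters_mul] at this
      have hy : x ∈ ({y} : Multiset (Fin (n + 1))) := by simp [this]
      exact absurd (Multiset.mem_singleton.1 hy).symm hxy
    · exact .inr ⟨indep_g.1 ha, hb⟩

end Trace

end Trace

end TwoBoundary

namespace TwoBoundary

open Trace

/-! ### The rewriting rules and their local confluence -/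

section Rules

variable {n : ℕ}

/-- `i` may be the outer letter of a rule `i j i → i`. -/
def Allowed (i : Fin (n + 1)) : Prop := (0 < i.val ∧ i.val < n) ∨ n = 1

/-- `i o i → i` is a rule: either `o` is absent, or it is a neighbour of `i` and `i` is allowed as
an outer letter. -/
def IsRule (i : Fin (n + 1)) (o : Option (Fin (n + 1))) : Prop :=
  ∀ j, o = some j → Near i j ∧ Allowed i

/-- The optional letter in the middle of a redex. -/
def mid : Option (Fin (n + 1)) → Trace n
  | none => 1
  | some j => g j

@[simp]
theorem mid_none : mid (none : Option (Fin (n + 1))) = 1 := rfl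

@[simp]
theorem mid_some (j : Fin (n + 1)) : mid (some j) = g j := rfl

/-- The left-hand side `i i` or `i j i` of a rule. -/
def redex (i : Fin (n + 1)) (o : Option (Fin (n + 1))) : Trace n := g i * (mid o * g i)

theorem redex_mul (i : Fin (n + 1)) (o : Option (Fin (n + 1))) (b : Trace n) :
    redex i o * b = g i * (mid o * (g i * b)) := by simp [redex, mul_assoc]

theorem len_redex (i : Fin (n + 1)) (o : Option (Fin (n + 1))) :
    2 ≤ len (redex i o) := by simp [redex]; omega

theorem indep_redex {x i : Fin (n + 1)} {o : Option (Fin (n + 1))} :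
    Indep x (redex i o) ↔ Far x i ∧ Indep x (mid o) := by
  simp only [redex, indep_mul, indep_g]
  tauto

theorem levi_mid {i k : Fin (n + 1)} {l : Option (Fin (n + 1))} {β b : Trace n}
    (hl : IsRule k l) (hik : Far i k) (h : g i * b = mid l * (g k * β)) :
    Indep i (mid l) ∧ ∃ β', β = g i * β' ∧ b = mid l * (g k * β') := by
  cases l with
  | none =>
    rw [mid_none, one_mul] at h
    rcases levi_g h with ⟨rfl, -⟩ | ⟨-, β', rfl, rfl⟩
    · omega
    · exact ⟨by simp, β', rfl, by simp⟩
  | some l =>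
    have hkl := (hl l rfl).1
    rw [mid_some] at h
    rcases levi_g h with ⟨rfl, -⟩ | ⟨hil, c, hc, rfl⟩
    · omega
    · rcases levi_g hc.symm with ⟨rfl, -⟩ | ⟨-, β', rfl, rfl⟩
      · omega
      · exact ⟨by simpa using hil, β', rfl, rfl⟩

/-- Neighbouring letters never pass each other, so the only letter of a redex that can move to the
front is its opening `k`; any other front letter must cross the whole redex. -/
theorem levi_redex_right {x k : Fin (n + 1)} {l : Option (Fin (n + 1))} {β b : Trace n}
    (hl : IsRule k l) (h : g x * b = redex k l * β) :
    (x = k ∧ b = mid l * (g k * β)) ∨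
      (Indep x (redex k l) ∧ ∃ β', β = g x * β' ∧ b = redex k l * β') := by
  rw [redex_mul] at h
  rcases levi_g h with ⟨rfl, rfl⟩ | ⟨hxk, c, hc, rfl⟩
  · exact .inl ⟨rfl, rfl⟩
  · obtain ⟨h₁, β', rfl, rfl⟩ := levi_mid hl hxk hc.symm
    exact .inr ⟨indep_redex.2 ⟨hxk, h₁⟩, β', rfl, by rw [redex_mul]⟩

/-- Adjacent letters cannot both be movable to the front, so the opening letter of a redex
determines its middle. -/
theorem mid_cancel {i : Fin (n + 1)} {o l : Option (Fin (n + 1))} {a b : Trace n}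
    (ho : IsRule i o) (hl : IsRule i l) (h : mid o * (g i * a) = mid l * (g i * b)) :
    o = l ∧ a = b := by
  have key : ∀ (j : Fin (n + 1)) (a b : Trace n), Near i j → g j * a = g i * b → False := by
    intro j a b hj h
    rcases levi_g h with ⟨rfl, -⟩ | ⟨h', -⟩ <;> omega
  cases o with
  | none =>
    cases l with
    | none => exact ⟨rfl, by simpa using h⟩
    | some l => exact (key l _ _ (hl l rfl).1 (by simpa using h.symm)).elim
  | some j =>
    cases l with
    | none => exact (key j _ _ (ho j rfl).1 (by simpa using h)).elim
    | some l =>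
      rcases levi_g (show g j * _ = g l * _ from h) with ⟨rfl, h'⟩ | ⟨-, c, hc, -⟩
      · exact ⟨rfl, g_mul_cancel h'⟩
      · exact (key j _ _ (ho j rfl).1 hc.symm).elim

/-- A redex on the left of a product `a * b` is split between `a` and `b`. -/
theorem levi_redex {i : Fin (n + 1)} {o : Option (Fin (n + 1))} {β a b : Trace n}
    (ho : IsRule i o) (h : redex i o * β = a * b) :
    (∃ a', a = redex i o * a' ∧ β = a' * b) ∨
    (∃ a' b', a = g i * (mid o * a') ∧ Indep i a' ∧ b = g i * b' ∧ β = a' * b') ∨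
    (∃ j a' b', o = some j ∧ a = g i * a' ∧ Indep i a' ∧ Indep j a' ∧
      b = g j * (g i * b') ∧ β = a' * b') ∨
    (Indep i a ∧ (∀ j, o = some j → Indep j a) ∧ ∃ b', b = redex i o * b' ∧ β = a * b') := by
  rw [redex_mul] at h
  rcases levi h with ⟨a₁, rfl, h₁⟩ | ⟨ha, b₁, rfl, h₁⟩
  · cases o with
    | none =>
      rw [mid_none, one_mul] at h₁
      rcases levi h₁ with ⟨a₂, rfl, rfl⟩ | ⟨h₂, b₂, rfl, rfl⟩
      · exact .inl ⟨a₂, by simp [redex_mul], rfl⟩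
      · exact .inr (.inl ⟨a₁, b₂, by simp, h₂, rfl, rfl⟩)
    | some j =>
      rcases levi (show g j * _ = a₁ * b from h₁) with ⟨a₂, rfl, h₂⟩ | ⟨ha₁, b₂, rfl, h₂⟩
      · rcases levi h₂ with ⟨a₃, rfl, rfl⟩ | ⟨h₃, b₃, rfl, rfl⟩
        · exact .inl ⟨a₃, by simp [redex_mul], rfl⟩
        · exact .inr (.inl ⟨a₂, b₃, by simp, h₃, rfl, rfl⟩)
      · rcases levi h₂ with ⟨a₃, rfl, rfl⟩ | ⟨h₃, b₃, rfl, rfl⟩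
        · have h₄ := (indep_g.1 (indep_mul.1 ha₁).1)
          have := (ho j rfl).1
          omega
        · exact .inr (.inr (.inl ⟨j, a₁, b₃, rfl, rfl, h₃, ha₁, rfl, rfl⟩))
  · have key : ∀ c d, g i * c = a * d → ∃ d', d = g i * d' ∧ c = a * d' := by
      intro c d hcd
      rcases levi hcd with ⟨a', rfl, -⟩ | ⟨-, h⟩
      · have := indep_g.1 (indep_mul.1 ha).1
        omega
      · exact h
    cases o with
    | none =>
      obtain ⟨b₂, rfl, rfl⟩ := key _ _ (by simpa using h₁)
      exact .inr (.inr (.inr ⟨ha, by simp, b₂, by simp [redex_mul], rfl⟩))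
    | some j =>
      rcases levi (show g j * _ = a * b₁ from h₁) with ⟨a₂, rfl, h₂⟩ | ⟨ha₁, b₂, rfl, h₂⟩
      · have := indep_g.1 (indep_mul.1 ha).1
        have := (ho j rfl).1
        omega
      · obtain ⟨b₃, rfl, rfl⟩ := key _ _ h₂
        exact .inr (.inr (.inr ⟨ha, by simpa using ha₁, b₃, by simp [redex_mul], rfl⟩))

theorem eq_one_or_exists_g_mul (a : Trace n) : a = 1 ∨ ∃ x a', a = g x * a' := by
  induction a using induction_left with
  | one => exact .inl rfl
  | mul x a => exact .inr ⟨x, a, rfl⟩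

end Rules

/-! ### Local confluence of the rewriting rules -/

section Confluence

variable {K : Type*} [Field K] {n : ℕ}

/-- The scalar produced by the rule `i o i → i`. -/
def coef (p : Params K) (i : Fin (n + 1)) : Option (Fin (n + 1)) → K
  | none => if i.val = 0 then p.δL else if i.val = n then p.δR else p.δ
  | some j => if j.val = 0 then p.κL else if j.val = n then p.κR else 1

/-- The scalar condition for the overlap `i j i j`. Both scalars are `1` unless `n = 1`, where they
are `κL` and `κR`; this is where `κL = κR` matters. -/
theorem coef_some_comm {p : Params K} (hp : p.κL = p.κR) {i j : Fin (n + 1)}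
    (hi : IsRule i (some j)) (hj : IsRule j (some i)) :
    coef p i (some j) = coef p j (some i) := by
  obtain ⟨h₁, h₂⟩ := hi j rfl
  obtain ⟨-, h₃⟩ := hj i rfl
  simp only [coef, hp]
  unfold Allowed at h₂ h₃
  split_ifs <;> first | rfl | omega

/-- The scalar condition for two redexes `i j i` and `k j k` sharing their middle letter, as in `i k
j i k`. -/
theorem coef_some_mul_coef_none (p : Params K) {i j k : Fin (n + 1)}
    (hi : IsRule i (some j)) (hk : IsRule k (some j)) :
    coef p i (some j) * coef p k none = coef p k (some j) * coef p i none := by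
  obtain ⟨h₁, h₂⟩ := hi j rfl
  obtain ⟨h₃, h₄⟩ := hk j rfl
  unfold Allowed at h₂ h₄
  have e : coef p i none = coef p k none := by
    simp only [coef]
    split_ifs <;> first | rfl | omega
  rw [e]
  rfl

variable {V : Type*} [AddCommGroup V] [Module K V]

/-- `F` respects the rules on traces of length less than `N`, and there it is compatible with left
multiplication by letters. -/
structure RespectsRules (p : Params K) (F : Trace n → V) (N : ℕ) : Prop where
  reduce : ∀ α i o β, IsRule i o → len (α * (redex i o * β)) < N →
    F (α * (redex i o * β)) = coef p i o • F (α * (g i * β))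
  extend : ∀ x, ∃ X : V →ₗ[K] V, ∀ a, len a + 1 < N → F (g x * a) = X (F a)

namespace RespectsRules

variable {p : Params K} {F : Trace n → V} {N : ℕ} {i k : Fin (n + 1)}
  {o l : Option (Fin (n + 1))} {α β α' β' : Trace n}

/-- A first letter `x` outside both redexes can be stripped: the shorter trace already has a
well-defined value, and `extend` carries the equality back through `x`. -/
theorem peel (hF : RespectsRules p F N) (x : Fin (n + 1)) (ho : IsRule i o) (hl : IsRule k l)
    (h : α * (redex i o * β) = α' * (redex k l * β'))
    (hN : len (α * (redex i o * β)) + 1 = N) :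
    coef p i o • F (g x * (α * (g i * β))) = coef p k l • F (g x * (α' * (g k * β'))) := by
  obtain ⟨X, hX⟩ := hF.extend x
  have hi := len_redex i o
  have hk := len_redex k l
  have e₁ := hF.reduce α i o β ho (by omega)
  have e₂ := hF.reduce α' k l β' hl (by rw [← h]; omega)
  have hN' := hN
  rw [h] at hN'
  simp only [len_mul] at hN hN'
  rw [hX _ (by simp; omega), hX _ (by simp; omega), ← map_smul, ← map_smul, ← e₁, ← e₂, h]

/-- For non-overlapping redexes, each reduct still contains the other redex, and contracting it
leads both to the same trace. -/
theorem disjoint (hF : RespectsRules p F N) (ho : IsRule i o) (hl : IsRule k l) {c b : Trace n}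
    (hN : len (α * (redex i o * β)) = N)
    (h₁ : α * (g i * β) = g i * (c * (redex k l * b)))
    (h₂ : α' * (g k * β') = redex i o * (c * (g k * b))) :
    coef p i o • F (α * (g i * β)) = coef p k l • F (α' * (g k * β')) := by
  have hi := len_redex i o
  have hk := len_redex k l
  have e₁ := hF.reduce (g i * c) k l b hl
  have e₂ := hF.reduce 1 i o (c * (g k * b)) ho
  have e := congrArg len h₁
  simp only [len_mul, len_g, mul_assoc, one_mul] at e e₁ e₂ hN
  rw [h₁, h₂, e₁ (by omega), e₂ (by omega), smul_comm]

/-- Two overlapping decompositions, one of which starts at the left end. -/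
theorem join_left (hp : p.κL = p.κR) (hF : RespectsRules p F N) (ho : IsRule i o)
    (hl : IsRule k l) (h : redex i o * β = α' * (redex k l * β'))
    (hN : len (redex i o * β) = N) :
    coef p i o • F (g i * β) = coef p k l • F (α' * (g k * β')) := by
  have disj : ∀ {c b : Trace n}, g i * β = g i * (c * (redex k l * b)) →
      α' * (g k * β') = redex i o * (c * (g k * b)) →
      coef p i o • F (g i * β) = coef p k l • F (α' * (g k * β')) := by
    intro c b h₁ h₂
    have := hF.disjoint (α := 1) ho hl (by simpa using hN) (by simpa using h₁) h₂
    simpa using this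
  rcases levi_redex ho h with ⟨a, rfl, rfl⟩ | ⟨a, b, rfl, ha, hb, rfl⟩ |
    ⟨j, a, b, rfl, rfl, ha, haj, hb, rfl⟩ | ⟨ha, hoa, b, hb, rfl⟩
  · exact disj rfl (by rw [mul_assoc])
  · rcases levi_redex_right hl hb.symm with ⟨rfl, rfl⟩ | ⟨hi, β'', rfl, rfl⟩
    -- Overlap `i o i l i`, with the closing `i` of one redex opening the other: both reducts
    -- contract once more to the same trace.
    · have e₁ := hF.reduce a i l β' hl
      have e₂ := hF.reduce 1 i o (a * β') ho
      rw [redex_mul, ha.comm_mul, ha.comm_mul] at e₁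
      rw [redex_mul, one_mul, one_mul] at e₂
      rw [mul_assoc, mul_assoc, ha.comm_mul]
      simp only [len_mul, len_g] at e₁ e₂ hN
      have := len_redex i o
      have := len_redex i l
      simp only [redex, len_mul, len_g] at hN this
      rw [e₁ (by omega), e₂ (by omega), smul_comm]
    · have hik := (indep_redex.1 hi).1
      refine disj (c := a) (b := β'') rfl ?_
      rw [(indep_g.2 hik).comm_mul, mul_assoc, mul_assoc, ha.comm_mul, redex_mul]
  · have hij := (ho j rfl).1
    rcases levi_redex_right hl hb.symm with ⟨rfl, hb'⟩ | ⟨hi, β'', rfl, hb'⟩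
    -- Overlap `i j i j`: the two reducts coincide as traces and only the scalars have to be
    -- compared.
    · cases l with
      | none =>
        rcases levi_g (show g i * b = g j * β' by simpa using hb') with ⟨rfl, -⟩ | ⟨_, _⟩ <;> omega
      | some l =>
        rcases levi_g (show g i * b = g l * (g j * β') from hb') with ⟨rfl, rfl⟩ | ⟨-, c, hc, -⟩
        · rw [mul_assoc, coef_some_comm hp ho hl]
        · rcases levi_g hc.symm with ⟨rfl, -⟩ | ⟨_, _⟩ <;> omega
    · have hjk := (indep_redex.1 hi).1
      rcases levi_redex_right hl hb' with ⟨rfl, -⟩ | ⟨hi', β', rfl, rfl⟩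
      · omega
      · have hik := (indep_redex.1 hi').1
        refine disj (c := a) (b := β') rfl ?_
        rw [(indep_g.2 hjk).comm_mul, (indep_g.2 hik).comm_mul, mul_assoc, haj.comm_mul,
          ha.comm_mul, redex_mul, mid_some]
  · have hb' := hb
    rw [redex_mul, eq_comm, redex_mul, ← redex_mul k] at hb'
    rcases levi_redex_right hl hb' with ⟨rfl, h'⟩ | ⟨hi, β'', rfl, h'⟩
    · obtain ⟨rfl, rfl⟩ := mid_cancel ho hl h'
      rw [ha.comm_mul]
    · have hik := (indep_redex.1 hi).1
      cases o with
      | none =>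
        rcases levi_redex_right hl (by simpa using h') with ⟨rfl, -⟩ | ⟨-, β', rfl, rfl⟩
        · omega
        · refine disj (c := α') (b := β') rfl ?_
          simp only [(indep_g.2 hik).comm_mul, ha.comm_mul, redex_mul, mid_none, one_mul]
      | some j =>
        have hij := (ho j rfl).1
        rcases levi_redex_right hl h' with ⟨rfl, -⟩ | ⟨hj, β', rfl, h''⟩
        · omega
        · have hjk := (indep_redex.1 hj).1
          rcases levi_redex_right hl h'' with ⟨rfl, -⟩ | ⟨-, β₃, rfl, rfl⟩
          · omega
          · refine disj (c := α') (b := β₃) rfl ?_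
            simp only [(indep_g.2 hik).comm_mul, (indep_g.2 hjk).comm_mul, ha.comm_mul,
              (hoa j rfl).comm_mul, redex_mul, mid_some]

/-- Two decompositions whose redexes start with two commuting minimal letters, when one of the
redexes is a square. -/
theorem join_none (hF : RespectsRules p F N) (hl : IsRule k l) (hik : Far i k)
    (hα : Indep i α) (hα' : Indep k α') (h : α * (g i * β) = α' * (mid l * (g k * β')))
    (hN : len (g k * α * (redex i none * β)) = N) :
    coef p i none • F (g k * α * (g i * β)) = coef p k l • F (g i * α' * (g k * β')) := by
  have hik' := indep_g.2 hik
  have ho : IsRule i none := fun j hj => by simp at hj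
  rw [hα.comm_mul] at h
  rcases levi h with ⟨a, rfl, h'⟩ | ⟨hi, b, hb, h'⟩
  · have hka := (indep_mul.1 hα').2
    refine hF.disjoint ho hl (c := a) (b := β') hN ?_ ?_
    · rw [mul_assoc, hα.comm_mul, h', hik'.comm_mul, redex_mul, hka.comm_mul]
    · simp only [redex_mul, mid_none, one_mul, mul_assoc]
  · obtain ⟨hil, β'', rfl, rfl⟩ := levi_mid hl hik hb.symm
    refine hF.disjoint ho hl (c := α') (b := β'') hN ?_ ?_
    · rw [mul_assoc, hα.comm_mul, h', hik'.comm_mul, redex_mul, hα'.comm_mul]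
    · simp only [redex_mul, mid_none, one_mul, mul_assoc, hik'.comm_mul, hi.comm_mul]

/-- The extra letter `x` either commutes with `i` and `k` and can be peeled off in front, or is the
middle letter `m` of the second redex. In the latter case the redexes do not share their middle
letter and are disjoint. -/
theorem join_some_of_cons (hF : RespectsRules p F N) {x j m : Fin (n + 1)}
    (ho : IsRule i (some j)) (hl : IsRule k (some m))
    (hik : Far i k) (hα : Indep i (g x * α)) (hα' : Indep k α')
    (h : g x * α * (g j * (g i * β)) = α' * (g m * (g k * β')))
    (hN : len (g k * (g x * α) * (redex i (some j) * β)) = N) :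
    coef p i (some j) • F (g k * (g x * α) * (g i * β)) =
      coef p k (some m) • F (g i * α' * (g k * β')) := by
  have hik' := indep_g.2 hik
  have hki' := indep_g.2 hik.symm
  have hij := (ho j rfl).1
  have hkm := (hl m rfl).1
  obtain ⟨hix, hiα⟩ := indep_mul.1 hα
  have hxi := indep_g.2 (indep_g.1 hix).symm
  rw [mul_assoc] at h
  rcases levi h with ⟨a, rfl, h'⟩ | ⟨hx, b, hb, h'⟩
  · obtain ⟨hkx, hka⟩ := indep_mul.1 hα'
    have hxk := indep_g.2 (indep_g.1 hkx).symm
    have := hF.peel (α := g k * α) (α' := g i * a) (β := β) (β' := β') x ho hl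
      (by simp only [redex_mul, mul_assoc, hiα.comm_mul, hka.comm_mul, hik'.comm_mul, mid_some, h'])
      (by simp only [len_mul, len_g] at hN ⊢; omega)
    simpa only [mul_assoc, hxk.comm_mul, hxi.comm_mul] using this
  · rcases levi_g hb.symm with ⟨rfl, rfl⟩ | ⟨hxm, c, hc, rfl⟩
    · rw [hα'.comm_mul] at h'
      have hN' : len (g i * α' * (redex k (some x) * β')) = N := by
        have := congrArg len h'
        simp only [len_mul, len_g, redex, mid_some] at hN this ⊢
        omega
      rcases levi h'.symm with ⟨a, rfl, h''⟩ | ⟨hkα, b, hb', h''⟩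
      · have hia := (indep_mul.1 hiα).2
        refine (hF.disjoint hl ho (c := a) (b := β) hN' ?_ ?_).symm
        · rw [mul_assoc, hα'.comm_mul, h'', hki'.comm_mul, redex_mul, mid_some, hia.comm_mul]
        · simp only [redex_mul, mid_some, mul_assoc]
      · obtain ⟨hkj, β'', rfl, rfl⟩ := levi_mid ho hik.symm hb'.symm
        refine (hF.disjoint hl ho (c := α) (b := β'') hN' ?_ ?_).symm
        · rw [mul_assoc, hα'.comm_mul, h'', hki'.comm_mul, redex_mul, mid_some, hiα.comm_mul]
        · simp only [redex_mul, mid_some, mul_assoc, hki'.comm_mul, hkα.comm_mul]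
    · rcases levi_g hc.symm with ⟨rfl, -⟩ | ⟨hxk, β'', rfl, rfl⟩
      · omega
      · have hxk' := indep_g.2 hxk
        have := hF.peel (α := g k * α) (α' := g i * α') (β := β) (β' := β'') x ho hl
          (by simp only [redex_mul, mul_assoc, hiα.comm_mul, hα'.comm_mul, hik'.comm_mul,
                mid_some, h'])
          (by simp only [len_mul, len_g] at hN ⊢; omega)
        simpa only [mul_assoc, hxk'.comm_mul, hxi.comm_mul, hx.comm_mul] using this

/-- Two decompositions whose redexes start with two commuting minimal letters. -/
theorem join_commuting (hF : RespectsRules p F N) (ho : IsRule i o) (hl : IsRule k l)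
    (hik : Far i k) (hα : Indep i α) (hα' : Indep k α')
    (h : α * (mid o * (g i * β)) = α' * (mid l * (g k * β')))
    (hN : len (g k * α * (redex i o * β)) = N)
    (hN' : len (g i * α' * (redex k l * β')) = N) :
    coef p i o • F (g k * α * (g i * β)) = coef p k l • F (g i * α' * (g k * β')) := by
  have hik' := indep_g.2 hik
  have hki' := indep_g.2 hik.symm
  cases o with
  | none => exact hF.join_none hl hik hα hα' (by simpa using h) hN
  | some j =>
    cases l with
    | none => exact (hF.join_none ho hik.symm hα' hα (by simpa using h.symm) hN').symm
    | some m =>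
      simp only [mid_some] at h
      rcases eq_one_or_exists_g_mul α with rfl | ⟨x, α₁, rfl⟩
      · rcases eq_one_or_exists_g_mul α' with rfl | ⟨x, α₁, rfl⟩
        · have hij := (ho j rfl).1
          have hkm := (hl m rfl).1
          rw [one_mul, one_mul] at h
          rcases levi_g h with ⟨rfl, h'⟩ | ⟨hjm, c, hc, hc'⟩
          · rcases levi_g h' with ⟨rfl, -⟩ | ⟨-, β'', rfl, rfl⟩
            · omega
            -- The trace is `i k j i k β''`. Contracting `i j i` leaves the square `k k`,
            -- contracting `k j k` leaves `i i`.
            · have hn : ∀ x : Fin (n + 1), IsRule x none := fun x j hj => by simp at hj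
              have e₁ := hF.reduce (g i) k none β'' (hn k)
              have e₂ := hF.reduce (g k) i none β'' (hn i)
              simp only [redex_mul, mid_none, mid_some, one_mul, len_mul, len_g] at e₁ e₂ hN
              rw [mul_one, mul_one, hik'.comm_mul, e₁ (by omega), hki'.comm_mul (g i * β''),
                e₂ (by omega), smul_smul, smul_smul, coef_some_mul_coef_none p ho hl, hki'.comm_mul]
          · rcases levi_g hc.symm with ⟨rfl, -⟩ | ⟨hjk, β₂, rfl, rfl⟩
            · omega
            · rcases levi_g hc' with ⟨rfl, -⟩ | ⟨him, c, hc, rfl⟩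
              · omega
              · rcases levi_g hc.symm with ⟨rfl, -⟩ | ⟨-, β₃, rfl, rfl⟩
                · omega
                · refine hF.disjoint ho hl (c := 1) (b := β₃) hN ?_ ?_
                  · simp only [mul_one, one_mul, redex_mul, mid_some, hik'.comm_mul]
                  · simp only [mul_one, one_mul, redex_mul, mid_some, hik'.comm_mul,
                      (indep_g.2 hjk).comm_mul]
        · exact (hF.join_some_of_cons hl ho hik.symm hα' hα h.symm hN').symm
      · exact hF.join_some_of_cons ho hl hik hα hα' h hN

/-- Any two one-step reductions of a trace of length `N` have the same image. -/
theorem join (hp : p.κL = p.κR) (hF : RespectsRules p F N) (ho : IsRule i o) (hl : IsRule k l)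
    (h : α * (redex i o * β) = α' * (redex k l * β'))
    (hN : len (α * (redex i o * β)) = N) :
    coef p i o • F (α * (g i * β)) = coef p k l • F (α' * (g k * β')) := by
  have hN' := hN
  rw [h] at hN'
  rcases eq_one_or_exists_g_mul α with rfl | ⟨x, α, rfl⟩
  · simpa using hF.join_left hp ho hl (by simpa using h) (by simpa using hN)
  rcases eq_one_or_exists_g_mul α' with rfl | ⟨y, α', rfl⟩
  · simpa using (hF.join_left hp hl ho (by simpa using h.symm) (by simpa using hN')).symm
  -- The first letter `x` of one decomposition is traced in the other: it can be peeled off unless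
  -- it opens the other redex. Applied both ways, this leaves only redexes opened by two commuting
  -- front letters.
  have aux : ∀ {i k x : Fin (n + 1)} {o l : Option (Fin (n + 1))} {α β α' β' : Trace n},
      IsRule i o → IsRule k l → g x * α * (redex i o * β) = α' * (redex k l * β') →
      len (g x * α * (redex i o * β)) = N →
      (coef p i o • F (g x * α * (g i * β)) = coef p k l • F (α' * (g k * β'))) ∨
        (x = k ∧ Indep k α') := by
    intro i k x o l α β α' β' ho hl h hN
    rw [mul_assoc] at h
    rcases levi h with ⟨a, rfl, h'⟩ | ⟨hx, b, hb, h'⟩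
    · have := hF.peel x ho hl h' (by simp only [len_mul, len_g] at hN ⊢; omega)
      exact .inl (by simpa only [mul_assoc] using this)
    · rcases levi_redex_right hl hb.symm with ⟨rfl, -⟩ | ⟨hxl, β'', rfl, rfl⟩
      · exact .inr ⟨rfl, hx⟩
      · have := hF.peel x ho hl h' (by simp only [len_mul, len_g] at hN ⊢; omega)
        exact .inl (by simpa only [mul_assoc, (indep_g.2 (indep_redex.1 hxl).1).comm_mul,
          hx.comm_mul] using this)
  rcases aux ho hl h hN with h₁ | ⟨rfl, hx⟩
  · exact h₁
  rcases aux hl ho h.symm hN' with h₁ | ⟨rfl, hy⟩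
  · exact h₁.symm
  have hik := indep_g.1 (indep_mul.1 hy).1
  have hα := (indep_mul.1 hy).2
  have hα' := (indep_mul.1 hx).2
  refine hF.join_commuting ho hl hik hα hα' ?_ hN hN'
  rw [mul_assoc, mul_assoc, redex_mul, redex_mul, hα.comm_mul, hα'.comm_mul,
    (indep_g.2 hik).comm_mul] at h
  exact g_mul_cancel (g_mul_cancel h)

end RespectsRules

end Confluence

end TwoBoundary

namespace TwoBoundary

open Trace

/-! ### Normal forms and the regular representation -/

section NormalForm

variable {K : Type*} [Field K] {n : ℕ}

/-- The trace `m` contains the left-hand side of a rule. -/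
def Reducible (m : Trace n) : Prop :=
  ∃ r : Trace n × Fin (n + 1) × Option (Fin (n + 1)) × Trace n,
    IsRule r.2.1 r.2.2.1 ∧ m = r.1 * (redex r.2.1 r.2.2.1 * r.2.2.2)

theorem reducible_of_isRule {i : Fin (n + 1)} {o : Option (Fin (n + 1))} (h : IsRule i o)
    (α β : Trace n) : Reducible (α * (redex i o * β)) := ⟨(α, i, o, β), h, rfl⟩

theorem Reducible.len_lt {m α β : Trace n} {i : Fin (n + 1)} {o : Option (Fin (n + 1))}
    (h : m = α * (redex i o * β)) : len (α * (g i * β)) < len m := by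
  have := len_redex i o
  rw [h]
  simp only [len_mul, len_g]
  omega

open Classical in
/-- The normal form of a trace: an irreducible trace with a scalar. -/
noncomputable def normalForm (p : Params K) (m : Trace n) : Trace n →₀ K :=
  if h : Reducible m then
    coef p h.choose.2.1 h.choose.2.2.1 •
      normalForm p (h.choose.1 * (g h.choose.2.1 * h.choose.2.2.2))
  else Finsupp.single m 1
termination_by len m
decreasing_by exact Reducible.len_lt h.choose_spec.2

theorem normalForm_of_not_reducible (p : Params K) {m : Trace n} (h : ¬ Reducible m) :
    normalForm p m = Finsupp.single m 1 := by
  rw [normalForm, dif_neg h]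

theorem exists_normalForm_eq (p : Params K) {m : Trace n} (h : Reducible m) :
    ∃ α i o β, IsRule i o ∧ m = α * (redex i o * β) ∧
      normalForm p m = coef p i o • normalForm p (α * (g i * β)) :=
  ⟨_, _, _, _, h.choose_spec.1, h.choose_spec.2, by rw [normalForm, dif_pos h]⟩

/-- The action of the generator `Uₓ`. -/
noncomputable def letterAction (p : Params K) (x : Fin (n + 1)) :
    (Trace n →₀ K) →ₗ[K] (Trace n →₀ K) :=
  Finsupp.linearCombination K fun m => normalForm p (g x * m)

theorem letterAction_single (p : Params K) (x : Fin (n + 1)) (m : Trace n) :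
    letterAction p x (Finsupp.single m 1) = normalForm p (g x * m) := by
  simp [letterAction]

/-- Confluence by induction on length: at length `N`, `join` compares an arbitrary redex with the
chosen one, using the statement below `N`. The map required by `extend` is `letterAction`. -/
theorem respectsRules_normalForm {p : Params K} (hp : p.κL = p.κR) (N : ℕ) :
    RespectsRules p (normalForm p : Trace n → Trace n →₀ K) N := by
  induction N with
  | zero => exact ⟨fun _ _ _ _ _ h => by simp at h, fun _ => ⟨0, fun _ h => by simp at h⟩⟩
  | succ N ih =>
    have reduce : ∀ (α : Trace n) i o β, IsRule i o → len (α * (redex i o * β)) < N + 1 →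
        normalForm p (α * (redex i o * β)) = coef p i o • normalForm p (α * (g i * β)) := by
      intro α i o β ho hN
      rcases Nat.lt_succ_iff_lt_or_eq.1 hN with h | h
      · exact ih.reduce α i o β ho h
      · obtain ⟨α', k, l, β', hl, e, h'⟩ := exists_normalForm_eq p (reducible_of_isRule ho α β)
        rw [h']
        exact (ih.join hp ho hl e h).symm
    refine ⟨reduce, fun x => ⟨letterAction p x, fun a => ?_⟩⟩
    induction hL : len a using Nat.strong_induction_on generalizing a with
    | _ L IH =>
      intro hLN
      by_cases h : Reducible a
      · obtain ⟨α, i, o, β, ho, e, h'⟩ := exists_normalForm_eq p h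
        have hlt := Reducible.len_lt e
        rw [h', map_smul, ← IH _ (by omega) _ rfl (by omega), e, ← mul_assoc,
          reduce _ _ _ _ ho, mul_assoc]
        rw [mul_assoc, ← e]
        simp only [len_mul, len_g]
        omega
      · rw [normalForm_of_not_reducible p h, letterAction_single]

theorem normalForm_redex {p : Params K} (hp : p.κL = p.κR) (α : Trace n) {i : Fin (n + 1)}
    {o : Option (Fin (n + 1))} (β : Trace n) (ho : IsRule i o) :
    normalForm p (α * (redex i o * β)) = coef p i o • normalForm p (α * (g i * β)) :=
  (respectsRules_normalForm hp _).reduce α i o β ho (Nat.lt_succ_self _)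

theorem letterAction_normalForm {p : Params K} (hp : p.κL = p.κR) (x : Fin (n + 1))
    (a : Trace n) : letterAction p x (normalForm p a) = normalForm p (g x * a) := by
  induction hL : len a using Nat.strong_induction_on generalizing a with
  | _ L IH =>
    by_cases h : Reducible a
    · obtain ⟨α, i, o, β, ho, e, h'⟩ := exists_normalForm_eq p h
      rw [h', map_smul, IH _ (hL ▸ Reducible.len_lt e) _ rfl, e, ← mul_assoc (g x) α,
        ← mul_assoc (g x) α, normalForm_redex hp _ _ ho]
    · rw [normalForm_of_not_reducible p h, letterAction_single]

theorem isRule_none (i : Fin (n + 1)) : IsRule i none := fun _ h => by simp at h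

theorem isRule_some {i j : Fin (n + 1)} (h : Near i j) (h' : Allowed i) : IsRule i (some j) := by
  rintro _ ⟨⟩
  exact ⟨h, h'⟩

theorem letterAction_sq {p : Params K} (hp : p.κL = p.κR) (i : Fin (n + 1)) :
    letterAction p i * letterAction p i = coef p i none • letterAction p i := by
  refine Finsupp.lhom_ext' fun m => LinearMap.ext_ring ?_
  have := normalForm_redex hp 1 m (isRule_none i)
  simp only [redex_mul, mid_none, one_mul] at this
  simpa [letterAction_single, letterAction_normalForm hp] using this

theorem letterAction_comm {p : Params K} (hp : p.κL = p.κR) {i j : Fin (n + 1)} (h : Far i j) :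
    letterAction p i * letterAction p j = letterAction p j * letterAction p i := by
  refine Finsupp.lhom_ext' fun m => LinearMap.ext_ring ?_
  simp [letterAction_single, letterAction_normalForm hp, (indep_g.2 h).comm_mul]

theorem letterAction_sandwich {p : Params K} (hp : p.κL = p.κR) {i j : Fin (n + 1)}
    (h : Near i j) (h' : Allowed i) :
    letterAction p i * letterAction p j * letterAction p i =
      coef p i (some j) • letterAction p i := by
  refine Finsupp.lhom_ext' fun m => LinearMap.ext_ring ?_
  have := normalForm_redex hp 1 m (isRule_some h h')
  simp only [redex_mul, mid_some, one_mul] at this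
  simpa [letterAction_single, letterAction_normalForm hp] using this

theorem letterAction_rel {p : Params K} (hn : 1 ≤ n) (hp : p.κL = p.κR)
    ⦃a b : FreeAlgebra K (Fin (n + 1))⦄ (h : TwoBTLRel n p a b) :
    FreeAlgebra.lift K (letterAction p) a = FreeAlgebra.lift K (letterAction p) b := by
  have left : ∀ i j : Fin (n + 1), i.val = 1 → j.val = 0 →
      letterAction p i * letterAction p j * letterAction p i = p.κL • letterAction p i := by
    intro i j hi hj
    rw [letterAction_sandwich hp (by omega) (by unfold Allowed; omega)]
    simp [coef, hj]
  have right : ∀ i j : Fin (n + 1), i.val + 1 = n → j.val = n →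
      letterAction p i * letterAction p j * letterAction p i = p.κR • letterAction p i := by
    intro i j hi hj
    rw [letterAction_sandwich hp (by omega) (by unfold Allowed; omega)]
    simp only [coef, if_neg (show ¬ j.val = 0 by omega), if_pos hj]
  rcases h with h | ⟨i, j, hi, hj⟩ | ⟨i, j, hi, hj⟩
  · rcases h with ⟨i, h⟩ | ⟨i, h⟩ | ⟨i, h₀, h⟩ | ⟨i, j, h⟩ | ⟨i, j, h, hi₀, hin, hj₀, hjn⟩ |
      ⟨i, j, h⟩ | ⟨i, j, h⟩
    · simp only [map_mul, map_smul, FreeAlgebra.lift_ι_apply, letterAction_sq hp, coef, if_pos h]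
    · simp only [map_mul, map_smul, FreeAlgebra.lift_ι_apply, letterAction_sq hp, coef,
        if_neg (show ¬ i.val = 0 by omega), if_pos h]
    · simp only [map_mul, map_smul, FreeAlgebra.lift_ι_apply, letterAction_sq hp, coef,
        if_neg (show ¬ i.val = 0 by omega), if_neg (show ¬ i.val = n by omega)]
    · simp only [map_mul, FreeAlgebra.lift_ι_apply]
      exact letterAction_comm hp h
    · simp only [map_mul, FreeAlgebra.lift_ι_apply]
      rw [letterAction_sandwich hp h (.inl ⟨hi₀, hin⟩)]
      simp only [coef, if_neg (show ¬ j.val = 0 by omega), if_neg (show ¬ j.val = n by omega),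
        one_smul]
    · simp only [map_mul, map_smul, FreeAlgebra.lift_ι_apply]
      rcases h with ⟨hi, hj⟩ | ⟨hi, hj⟩
      -- The quartic relation follows by contracting its last three factors, or its first three in
      -- the other orientation.
      · rw [mul_assoc, mul_assoc, ← mul_assoc (letterAction p j), left j i hj hi, mul_smul_comm]
      · rw [left i j hi hj, smul_mul_assoc]
    · simp only [map_mul, map_smul, FreeAlgebra.lift_ι_apply]
      rcases h with ⟨hi, hj⟩ | ⟨hi, hj⟩
      · rw [right i j hi hj, smul_mul_assoc]
      · rw [mul_assoc, mul_assoc, ← mul_assoc (letterAction p j), right j i hj hi, mul_smul_comm]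
  · simpa only [map_mul, map_smul, FreeAlgebra.lift_ι_apply] using left i j hi hj
  · simpa only [map_mul, map_smul, FreeAlgebra.lift_ι_apply] using right i j hi hj

/-- The representation of the two-boundary algebra on the space of traces. -/
noncomputable def traceRep {p : Params K} (hn : 1 ≤ n) (hp : p.κL = p.κR) :
    TwoBTL n p →ₐ[K] Module.End K (Trace n →₀ K) :=
  RingQuot.liftAlgHom K ⟨FreeAlgebra.lift K (letterAction p), letterAction_rel hn hp⟩

/-- The generator `Uᵢ` of the two-boundary algebra. -/
noncomputable def gen (n : ℕ) (p : Params K) (i : Fin (n + 1)) : TwoBTL n p :=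
  RingQuot.mkAlgHom K (TwoBTLRel n p) (u K i)

theorem traceRep_gen {p : Params K} (hn : 1 ≤ n) (hp : p.κL = p.κR) (i : Fin (n + 1)) :
    traceRep hn hp (gen n p i) = letterAction p i := by
  rw [traceRep, gen, RingQuot.liftAlgHom_mkAlgHom_apply, FreeAlgebra.lift_ι_apply]

theorem not_reducible_one : ¬ Reducible (1 : Trace n) := by
  rintro ⟨r, -, h⟩
  have := congrArg len h
  have := len_redex r.2.1 r.2.2.1
  simp only [len_one, len_mul] at *
  omega

theorem traceRep_prod_gen {p : Params K} (hn : 1 ≤ n) (hp : p.κL = p.κR)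
    (ω : List (Fin (n + 1))) :
    traceRep hn hp (ω.map (gen n p)).prod (Finsupp.single 1 1) = normalForm p (mk ω) := by
  induction ω with
  | nil => simp [normalForm_of_not_reducible p not_reducible_one]
  | cons i ω ih =>
    rw [List.map_cons, List.prod_cons, map_mul, Module.End.mul_apply, ih, traceRep_gen,
      letterAction_normalForm hp, mk_cons]

/-- The coefficients of traces of length at least `r` vanish. -/
def SupportedBelow (r : ℕ) (v : Trace n →₀ K) : Prop := ∀ m, r ≤ len m → v m = 0

theorem supportedBelow_normalForm (p : Params K) (a : Trace n) :
    SupportedBelow (len a + 1) (normalForm p a) := by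
  induction hL : len a using Nat.strong_induction_on generalizing a with
  | _ L IH =>
    subst hL
    by_cases h : Reducible a
    · obtain ⟨α, i, o, β, -, e, h'⟩ := exists_normalForm_eq p h
      have hlt := Reducible.len_lt e
      intro m hm
      rw [h', Finsupp.smul_apply, IH _ hlt _ rfl m (by omega), smul_zero]
    · intro m hm
      rw [normalForm_of_not_reducible p h, Finsupp.single_eq_of_ne]
      rintro rfl
      omega

theorem supportedBelow_normalForm_of_reducible (p : Params K) {a : Trace n} (h : Reducible a) :
    SupportedBelow (len a) (normalForm p a) := by
  obtain ⟨α, i, o, β, -, e, h'⟩ := exists_normalForm_eq p h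
  have hlt := Reducible.len_lt e
  intro m hm
  rw [h', Finsupp.smul_apply, supportedBelow_normalForm p _ m (by omega), smul_zero]

theorem SupportedBelow.letterAction {p : Params K} {r : ℕ} {v : Trace n →₀ K}
    (h : SupportedBelow r v) (x : Fin (n + 1)) :
    SupportedBelow (r + 1) (letterAction p x v) := by
  intro m hm
  rw [TwoBoundary.letterAction, Finsupp.linearCombination_apply, Finsupp.sum,
    Finsupp.finsetSum_apply]
  refine Finset.sum_eq_zero fun a ha => ?_
  have ha' : len a < r := by
    by_contra hc
    exact Finsupp.mem_support_iff.1 ha (h a (not_lt.1 hc))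
  rw [Finsupp.smul_apply, supportedBelow_normalForm p _ m (by simp; omega), smul_zero]

end NormalForm

end TwoBoundary

namespace TwoBoundary

open Trace

/-! ### The relations of the two-boundary algebra -/

section Relations

variable {K : Type*} [Field K] {n : ℕ} {p : Params K}

theorem gen_sq (i : Fin (n + 1)) : gen n p i * gen n p i = coef p i none • gen n p i := by
  simp only [gen, coef, ← map_mul, ← map_smul]
  split_ifs with h₀ h₁
  · exact RingQuot.mkAlgHom_rel K (.tl (.sq_left i h₀))
  · exact RingQuot.mkAlgHom_rel K (.tl (.sq_right i h₁))
  · exact RingQuot.mkAlgHom_rel K (.tl (.sq_mid i (by omega) (by omega)))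

theorem gen_comm {i j : Fin (n + 1)} (h : Far i j) :
    gen n p i * gen n p j = gen n p j * gen n p i := by
  simp only [gen, ← map_mul]
  exact RingQuot.mkAlgHom_rel K (.tl (.comm i j h))

theorem gen_sandwich {i j : Fin (n + 1)} (h : Near i j) (h' : Allowed i) :
    gen n p i * gen n p j * gen n p i = coef p i (some j) • gen n p i := by
  simp only [gen, coef, ← map_mul, ← map_smul]
  unfold Allowed at h'
  split_ifs with h₀ h₁
  · exact RingQuot.mkAlgHom_rel K (.left i j (by omega) h₀)
  · exact RingQuot.mkAlgHom_rel K (.right i j (by omega) h₁)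
  · rw [one_smul]
    exact RingQuot.mkAlgHom_rel K
      (.tl (.cubic i j h (by omega) (by omega) (by omega) (by omega)))

/-- The product of generators attached to a trace. -/
noncomputable def genProd (p : Params K) : Trace n → TwoBTL n p :=
  Trace.lift (fun ω => (ω.map (gen n p)).prod) fun _ _ h => by
    obtain ⟨α, β, s, t, h⟩ := h
    simp only [List.map_append, List.map_cons, List.map_nil, List.prod_append, List.prod_cons,
      List.prod_nil, mul_one, gen_comm (p := p) (affineC_eq_two_iff.1 h)]

theorem genProd_mk (ω : List (Fin (n + 1))) :
    genProd p (mk ω) = (ω.map (gen n p)).prod := rfl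

theorem genProd_g (i : Fin (n + 1)) : genProd p (g i) = gen n p i := by
  simp [g, genProd_mk]

theorem genProd_mul (a b : Trace n) : genProd p (a * b) = genProd p a * genProd p b := by
  obtain ⟨a, rfl⟩ := mk_surjective a
  obtain ⟨b, rfl⟩ := mk_surjective b
  rw [← mk_append]
  simp [genProd_mk]

theorem genProd_redex {i : Fin (n + 1)} {o : Option (Fin (n + 1))} (h : IsRule i o) :
    genProd p (redex i o) = coef p i o • gen n p i := by
  cases o with
  | none => simp [redex, genProd_mul, genProd_g, gen_sq]
  | some j =>
    rw [← gen_sandwich (h j rfl).1 (h j rfl).2]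
    simp [redex, genProd_mul, genProd_g, mul_assoc]

theorem proj_monomial (ω : List (Fin (n + 1))) :
    proj n p (monomial n p ω) = genProd p (mk ω) := by
  rw [monomial, map_list_prod, List.map_map, genProd_mk]
  congr 2
  funext i
  exact RingQuot.liftAlgHom_mkAlgHom_apply K _ _ _

theorem monomial_eq_of_commEquiv {ω ω' : List (Fin (n + 1))}
    (h : Relation.ReflTransGen (CommStep n) ω ω') : monomial n p ω = monomial n p ω' := by
  induction h with
  | refl => rfl
  | tail _ h ih =>
    rw [ih]
    obtain ⟨α, β, s, t, h⟩ := h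
    have : U n p s * U n p t = U n p t * U n p s := by
      simp only [U, ← map_mul]
      exact RingQuot.mkAlgHom_rel K (.comm s t (affineC_eq_two_iff.1 h))
    simp only [monomial, List.map_append, List.map_cons, List.map_nil, List.prod_append,
      List.prod_cons, List.prod_nil, mul_one, this]

end Relations

/-! ### The Coxeter group inside the two-boundary algebra at `q = Q = 1` -/

section Involutions

variable {A : Type*} [Ring A] {x y : A}

theorem one_sub_mul_self (hx : x * x = x + x) : (1 - x) * (1 - x) = 1 := by
  simp only [mul_sub, sub_mul, mul_one, one_mul, hx]
  abel

theorem mul_pow_two_of_comm {a b : A} (ha : a * a = 1) (hb : b * b = 1) (h : a * b = b * a) :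
    (a * b) ^ 2 = 1 := by
  rw [pow_two, mul_assoc, ← mul_assoc b, ← h, mul_assoc a b b, hb, mul_one, ha]

theorem mul_pow_three_of_braid {a b : A} (ha : a * a = 1) (hb : b * b = 1)
    (h : a * b * a = b * a * b) : (a * b) ^ 3 = 1 := by
  have : (a * b) ^ 3 = a * b * a * (b * a * b) := by
    simp only [pow_succ, pow_zero, one_mul, mul_assoc]
  rw [this, ← h]
  simp only [mul_assoc]
  rw [← mul_assoc a a, ha, one_mul, ← mul_assoc b b, hb, one_mul, ha]

theorem mul_pow_four_of_braid {a b : A} (ha : a * a = 1) (hb : b * b = 1)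
    (h : a * b * a * b = b * a * b * a) : (a * b) ^ 4 = 1 := by
  have : (a * b) ^ 4 = a * b * a * b * (a * b * a * b) := by
    simp only [pow_succ, pow_zero, one_mul, mul_assoc]
  rw [this]
  nth_rw 2 [h]
  simp only [mul_assoc]
  rw [← mul_assoc b b, hb, one_mul, ← mul_assoc a a, ha, one_mul, ← mul_assoc b b, hb, one_mul, ha]

theorem one_sub_braid_three (hx : x * x = x + x) (hy : y * y = y + y) (hxy : x * y * x = x)
    (hyx : y * x * y = y) :
    (1 - x) * (1 - y) * (1 - x) = (1 - y) * (1 - x) * (1 - y) := by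
  simp only [mul_sub, sub_mul, mul_one, one_mul, hx, hy, hxy, hyx]
  abel

theorem one_sub_braid_four (hx : x * x = x + x) (hy : y * y = y + y)
    (hxy : x * y * x * y = x * y + x * y) (hyx : y * x * y * x = y * x + y * x) :
    (1 - x) * (1 - y) * (1 - x) * (1 - y) = (1 - y) * (1 - x) * (1 - y) * (1 - x) := by
  have hx' : ∀ z, z * x * x = z * x + z * x := fun z => by rw [mul_assoc, hx, mul_add]
  have hy' : ∀ z, z * y * y = z * y + z * y := fun z => by rw [mul_assoc, hy, mul_add]
  simp only [mul_sub, sub_mul, mul_one, one_mul, add_mul, hx, hy, hx', hy', hxy, hyx]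
  abel

end Involutions

section CoxeterRep

variable {n : ℕ}

/-- The parameters at `q = Q = 1`. -/
noncomputable def unitParams : Params ℚ := Params.special 1 1 1 1

theorem unitParams_κ : unitParams.κL = unitParams.κR := rfl

theorem coef_unitParams_none (i : Fin (n + 1)) : coef unitParams i none = 2 := by
  simp only [coef, unitParams, Params.special]
  norm_num

theorem coef_unitParams_some (i j : Fin (n + 1)) :
    coef unitParams i (some j) = if j.val = 0 ∨ j.val = n then 2 else 1 := by
  simp only [coef, unitParams, Params.special]
  split_ifs <;> first | omega | norm_num

/-- At `q = Q = 1` one has `Uᵢ² = 2Uᵢ`, so `1 - Uᵢ` is an involution; the sandwich relations yield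
the braid relations of lengths three and four. -/
theorem isLiftable_one_sub_gen :
    (affineC n).IsLiftable fun i => 1 - gen n unitParams i := by
  have hsq : ∀ i : Fin (n + 1),
      gen n unitParams i * gen n unitParams i = gen n unitParams i + gen n unitParams i := by
    intro i
    rw [gen_sq, coef_unitParams_none, two_smul]
  have hinv := fun i => one_sub_mul_self (hsq i)
  intro i j
  rw [affineC_apply]
  split_ifs with h₁ h₂ h₃
  · subst h₁
    rw [pow_one, hinv]
  · refine mul_pow_four_of_braid (hinv i) (hinv j) ?_
    have key : ∀ i j : Fin (n + 1), Near i j → j.val = 0 ∨ j.val = n →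
        gen n unitParams i * gen n unitParams j * gen n unitParams i =
          gen n unitParams i + gen n unitParams i := by
      intro i j h h'
      rw [gen_sandwich h (by unfold Allowed; omega), coef_unitParams_some, if_pos h', two_smul]
    by_cases h : j.val = 0 ∨ j.val = n
    · have := key i j h₂ h
      refine one_sub_braid_four (hsq i) (hsq j) ?_ ?_
      · rw [this, add_mul]
      · rw [mul_assoc, mul_assoc, ← mul_assoc (gen n unitParams i), this, mul_add]
    · have := key j i h₂.symm (by omega)
      refine one_sub_braid_four (hsq i) (hsq j) ?_ ?_
      · rw [mul_assoc, mul_assoc, ← mul_assoc (gen n unitParams j), this, mul_add]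
      · rw [this, add_mul]
  · refine mul_pow_three_of_braid (hinv i) (hinv j)
      (one_sub_braid_three (hsq i) (hsq j) ?_ ?_)
    · rw [gen_sandwich h₂ (by unfold Allowed; omega), coef_unitParams_some, if_neg (by omega),
        one_smul]
    · rw [gen_sandwich h₂.symm (by unfold Allowed; omega), coef_unitParams_some,
        if_neg (by omega), one_smul]
  · refine mul_pow_two_of_comm (hinv i) (hinv j) ?_
    have hf : Far i j := by
      have := Fin.val_ne_of_ne h₁
      omega
    simp only [mul_sub, sub_mul, mul_one, one_mul, gen_comm hf]
    abel

/-- The homomorphism `σᵢ ↦ 1 - Uᵢ`. -/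
noncomputable def coxeterHom (n : ℕ) : W n →* TwoBTL n unitParams :=
  (cs n).lift ⟨_, isLiftable_one_sub_gen⟩

theorem coxeterHom_simple (i : Fin (n + 1)) :
    coxeterHom n ((cs n).simple i) = 1 - gen n unitParams i :=
  (cs n).lift_apply_simple isLiftable_one_sub_gen i

/-- The image of a group element under the trace representation at `q = Q = 1`. -/
noncomputable def coxeterVec (hn : 1 ≤ n) (w : W n) : Trace n →₀ ℚ :=
  traceRep hn unitParams_κ (coxeterHom n w) (Finsupp.single 1 1)

/-- Expanding the product of the factors `1 - Uᵢ`, only the full product, with sign `(-1)^|ω|`, can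
reach length `|ω|`. -/
theorem supportedBelow_coxeterVec_sub (hn : 1 ≤ n) (ω : List (Fin (n + 1))) :
    SupportedBelow ω.length (coxeterVec hn ((cs n).wordProd ω) -
      (-1 : ℚ) ^ ω.length • normalForm unitParams (mk ω)) := by
  induction ω with
  | nil =>
    intro m _
    simp [coxeterVec, normalForm_of_not_reducible _ not_reducible_one]
  | cons i ω ih =>
    have e : coxeterVec hn ((cs n).wordProd (i :: ω)) -
        (-1 : ℚ) ^ (i :: ω).length • normalForm unitParams (mk (i :: ω)) =
        coxeterVec hn ((cs n).wordProd ω) -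
          letterAction unitParams i (coxeterVec hn ((cs n).wordProd ω) -
            (-1 : ℚ) ^ ω.length • normalForm unitParams (mk ω)) := by
      rw [map_sub, map_smul, letterAction_normalForm unitParams_κ, ← mk_cons, List.length_cons,
        pow_succ, coxeterVec, CoxeterSystem.wordProd_cons, map_mul, coxeterHom_simple, sub_mul,
        one_mul, map_sub, map_mul, traceRep_gen, LinearMap.sub_apply, Module.End.mul_apply]
      simp only [coxeterVec]
      module
    rw [e]
    intro m hm
    rw [Finsupp.sub_apply, ih.letterAction i m hm]
    have h₁ := ih m (by simp at hm; omega)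
    have h₂ := supportedBelow_normalForm unitParams (mk ω) m (by simpa using hm)
    rw [Finsupp.sub_apply, Finsupp.smul_apply, h₂, smul_zero] at h₁
    rw [sub_zero]
    simpa using h₁

/-- An irreducible word is a shortest expression of its product, and it is the only one up to
commutations. -/
theorem length_le_and_mk_eq (hn : 1 ≤ n) {ω ω' : List (Fin (n + 1))} (hω : ¬ Reducible (mk ω))
    (h : (cs n).wordProd ω' = (cs n).wordProd ω) :
    ω.length ≤ ω'.length ∧ (ω'.length ≤ ω.length → mk ω' = mk ω) := by
  have h₁ := supportedBelow_coxeterVec_sub hn ω (mk ω) le_rfl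
  rw [normalForm_of_not_reducible _ hω, Finsupp.sub_apply, Finsupp.smul_apply,
    Finsupp.single_eq_same, sub_eq_zero, ← h] at h₁
  have h₂ : coxeterVec hn ((cs n).wordProd ω') (mk ω) ≠ 0 := by
    rw [h₁]
    simp
  have h₃ : ω'.length ≤ ω.length → normalForm unitParams (mk ω') (mk ω) ≠ 0 := by
    intro hle h0
    have := supportedBelow_coxeterVec_sub hn ω' (mk ω) hle
    rw [Finsupp.sub_apply, Finsupp.smul_apply, h0, smul_zero, sub_zero] at this
    exact h₂ this
  have hle : ω.length ≤ ω'.length := by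
    by_contra hlt
    exact h₃ (by omega) (supportedBelow_normalForm unitParams (mk ω') (mk ω) (by simp; omega))
  refine ⟨hle, fun hle' => ?_⟩
  have h₄ := h₃ hle'
  have hred : ¬ Reducible (mk ω') := fun hr =>
    h₄ (supportedBelow_normalForm_of_reducible unitParams hr (mk ω) hle')
  rw [normalForm_of_not_reducible _ hred] at h₄
  by_contra hne
  exact h₄ (Finsupp.single_eq_of_ne (Ne.symm hne))

end CoxeterRep

end TwoBoundary

namespace TwoBoundary

open Trace

/-! ### Positive fully commutative elements and irreducible words -/

section Positive

variable {n : ℕ}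

theorem wordProd_eq_of_mk_eq {ω ω' : List (Fin (n + 1))} (h : mk ω = mk ω') :
    (cs n).wordProd ω = (cs n).wordProd ω' := by
  induction mk_eq_mk.1 h with
  | refl => rfl
  | tail h₁ h₂ ih =>
    rw [ih (mk_eq_mk.2 h₁)]
    obtain ⟨α, β, s, t, hst₂⟩ := h₂
    have hst : (cs n).simple s * (cs n).simple t = (cs n).simple t * (cs n).simple s := by
      have := (cs n).simple_mul_simple_pow s t
      rw [hst₂, pow_two] at this
      have := eq_inv_of_mul_eq_one_left this
      rwa [mul_inv_rev, (cs n).inv_simple, (cs n).inv_simple] at this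
    simp only [CoxeterSystem.wordProd_append, CoxeterSystem.wordProd_cons,
      CoxeterSystem.wordProd_nil, mul_one, hst]

theorem isReducedExpr_iff {w : W n} {ω : List (Fin (n + 1))} :
    IsReducedExpr w ω ↔ (cs n).wordProd ω = w ∧ (cs n).length w = ω.length := by
  constructor
  · rintro ⟨h, rfl⟩
    exact ⟨rfl, h⟩
  · rintro ⟨rfl, h⟩
    exact ⟨h, rfl⟩

theorem IsReducedExpr.of_mk_eq {w : W n} {ω ω' : List (Fin (n + 1))} (h : IsReducedExpr w ω)
    (hm : mk ω = mk ω') : IsReducedExpr w ω' := by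
  rw [isReducedExpr_iff] at *
  have := congrArg len hm
  rw [len_mk, len_mk] at this
  exact ⟨by rw [← wordProd_eq_of_mk_eq hm, h.1], by omega⟩

/-- Replacing a factor of a reduced expression by another expression of the same element that is not
longer yields a reduced expression. -/
theorem IsReducedExpr.replace {w : W n} {α υ υ' β : List (Fin (n + 1))}
    (h : IsReducedExpr w (α ++ υ ++ β)) (hυ : (cs n).wordProd υ' = (cs n).wordProd υ)
    (hle : υ'.length ≤ υ.length) : IsReducedExpr w (α ++ υ' ++ β) := by
  rw [isReducedExpr_iff] at *
  have e : (cs n).wordProd (α ++ υ' ++ β) = w := by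
    rw [← h.1]
    simp only [CoxeterSystem.wordProd_append, hυ]
  refine ⟨e, ?_⟩
  have := (cs n).length_wordProd_le (α ++ υ' ++ β)
  rw [e] at this
  have h₂ := h.2
  simp only [List.length_append] at *
  omega

theorem IsReducedExpr.factor {w : W n} {α υ β : List (Fin (n + 1))}
    (h : IsReducedExpr w (α ++ υ ++ β)) : IsReducedExpr ((cs n).wordProd υ) υ := by
  have h₁ := h.1.take (α ++ υ).length
  rw [List.take_left] at h₁
  have h₂ := h₁.drop α.length
  rw [List.drop_left] at h₂
  exact ⟨h₂, rfl⟩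

theorem not_reducible_of_length_two {i j : Fin (n + 1)} (hij : i ≠ j) :
    ¬ Reducible (mk [i, j]) := by
  rintro ⟨⟨α, k, o, β⟩, -, h⟩
  have := congrArg letters h
  simp only [redex, letters_mk, letters_mul, letters_g] at this
  have := congrArg (Multiset.count k) this
  simp only [Multiset.count_add, Multiset.count_singleton_self, Multiset.coe_count,
    List.count_cons, List.count_nil, beq_iff_eq] at this
  split_ifs at this with h₁ h₂
  · exact hij (h₂.trans h₁.symm)
  all_goals omega

/-- The word `i j i` is reduced when `i` and `j` are adjacent. -/
theorem three_le_length_of_wordProd_eq (hn : 1 ≤ n) {i j : Fin (n + 1)} (h : Near i j)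
    {υ : List (Fin (n + 1))} (hυ : (cs n).wordProd υ = (cs n).wordProd [i, j, i]) :
    3 ≤ υ.length := by
  have hij : i ≠ j := by
    rintro rfl
    omega
  -- The length parity is a homomorphism, so only length one remains to be excluded. If `σₖ =
  -- σᵢσⱼσᵢ`, then `k i` and the irreducible word `i j` have the same product, hence the same trace,
  -- which is impossible.
  have hpar : υ.length % 2 = 1 := by
    have key : ∀ ω : List (Fin (n + 1)), (cs n).lengthParity ((cs n).wordProd ω) =
        Multiplicative.ofAdd (ω.length : ZMod 2) := by
      intro ω
      induction ω with
      | nil => simp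
      | cons i ω ih =>
        rw [CoxeterSystem.wordProd_cons, map_mul, ih, CoxeterSystem.lengthParity_simple,
          ← ofAdd_add, List.length_cons, Nat.cast_succ, add_comm]
    have := key υ
    rw [hυ, key] at this
    have := (ZMod.natCast_eq_natCast_iff' 3 υ.length 2).1 (Multiplicative.ofAdd.injective this)
    omega
  by_contra hlt
  obtain ⟨k, rfl⟩ := List.length_eq_one_iff.1 (show υ.length = 1 by omega)
  have e : (cs n).wordProd [k, i] = (cs n).wordProd [i, j] := by
    simp only [CoxeterSystem.wordProd_cons, CoxeterSystem.wordProd_nil, mul_one] at hυ ⊢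
    rw [hυ, mul_assoc, mul_assoc, CoxeterSystem.simple_mul_simple_self, mul_one]
  have hmk := (length_le_and_mk_eq hn (not_reducible_of_length_two hij) e).2 le_rfl
  rw [mk_cons k, mk_cons i [j]] at hmk
  rcases levi_g hmk with ⟨-, h'⟩ | ⟨h₁, b', h', h''⟩
  · have := congrArg letters h'
    rw [letters_mk, letters_mk] at this
    simp at this
    exact hij this
  · have := congrArg letters h'
    have h₂ : k ∈ letters (mk [j]) := by rw [this]; simp
    simp at h₂
    omega

/-- Containment may be witnessed by any reduced expression of `σᵢσⱼσᵢ`. Replacing it by `i j i`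
gives a reduced expression with a redex, which by uniqueness has the trace of `ω`. -/
theorem avoids_of_not_reducible (hn : 1 ≤ n) {ω : List (Fin (n + 1))} (hω : ¬ Reducible (mk ω))
    {i j : Fin (n + 1)} (h : Near i j) (h' : Allowed i) :
    Avoids ((cs n).wordProd ω) ((cs n).simple i * (cs n).simple j * (cs n).simple i) := by
  rintro ⟨ω', υ, hω', hυ, α, β, rfl⟩
  have e : (cs n).wordProd [i, j, i] = (cs n).wordProd υ := by
    rw [hυ.2]
    simp [CoxeterSystem.wordProd_cons, mul_assoc]
  have hr := hω'.replace e (three_le_length_of_wordProd_eq hn h e.symm)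
  rw [isReducedExpr_iff] at hr
  have hle := (cs n).length_wordProd_le ω
  have := (length_le_and_mk_eq hn hω hr.1).2 (by omega)
  refine hω ⟨(mk α, i, some j, mk β), isRule_some h h', ?_⟩
  rw [← this, mk_append, mk_append, mul_assoc]
  rfl

theorem isReducedExpr_and_isFullyCommutative (hn : 1 ≤ n) {ω : List (Fin (n + 1))}
    (hω : ¬ Reducible (mk ω)) : IsReducedExpr ((cs n).wordProd ω) ω ∧
      IsFullyCommutative ((cs n).wordProd ω) := by
  have key : ∀ ω', IsReducedExpr ((cs n).wordProd ω) ω' → mk ω' = mk ω := by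
    intro ω' h
    rw [isReducedExpr_iff] at h
    have hle := (cs n).length_wordProd_le ω
    exact (length_le_and_mk_eq hn hω h.1).2 (by omega)
  refine ⟨?_, fun ω₁ ω₂ h₁ h₂ => mk_eq_mk.1 ((key _ h₁).trans (key _ h₂).symm)⟩
  obtain ⟨ω₀, h₀⟩ := exists_reducedExpr ((cs n).wordProd ω)
  exact h₀.of_mk_eq (key _ h₀)

theorem val_vtx {i : ℕ} (h : i ≤ n) : (vtx n i).val = i := by
  simp [Nat.mod_eq_of_lt (Nat.lt_succ_of_le h)]

theorem wordProd_mem_positive (hn : 1 ≤ n) {ω : List (Fin (n + 1))}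
    (hω : ¬ Reducible (mk ω)) : (cs n).wordProd ω ∈ positive n := by
  have hfc := (isReducedExpr_and_isFullyCommutative hn hω).2
  have h₀ := val_vtx (Nat.zero_le n)
  have h₁ := val_vtx hn
  have h₂ := val_vtx (Nat.sub_le n 1)
  have h₃ := val_vtx (le_refl n)
  exact ⟨⟨hfc, avoids_of_not_reducible hn hω (i := vtx n 1) (j := vtx n 0) (by omega)
      (by unfold Allowed; omega)⟩,
    ⟨hfc, avoids_of_not_reducible hn hω (i := vtx n (n - 1)) (j := vtx n n) (by omega)
      (by unfold Allowed; omega)⟩⟩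

theorem not_reducible_of_mem_positive (hn : 1 ≤ n) {w : W n} (hw : w ∈ positive n)
    {ω : List (Fin (n + 1))} (hω : IsReducedExpr w ω) : ¬ Reducible (mk ω) := by
  rintro ⟨⟨α, i, o, β⟩, ho, h⟩
  dsimp only at ho h
  obtain ⟨α, rfl⟩ := mk_surjective α
  obtain ⟨β, rfl⟩ := mk_surjective β
  cases o with
  | none =>
    have h' : mk ω = mk (α ++ [i, i] ++ β) := by
      rw [h, mk_append, mk_append, mul_assoc]
      rfl
    have hr := (hω.of_mk_eq h').replace (υ' := []) 
      (by rw [CoxeterSystem.wordProd_cons, CoxeterSystem.wordProd_cons,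
        CoxeterSystem.simple_mul_simple_cancel_left])
      (by simp)
    have h₁ := (isReducedExpr_iff.1 hr).2
    have h₂ := (isReducedExpr_iff.1 (hω.of_mk_eq h')).2
    simp at h₁ h₂
    omega
  | some j =>
    have h' : mk ω = mk (α ++ [i, j, i] ++ β) := by
      rw [h, mk_append, mk_append, mul_assoc]
      rfl
    have hr := hω.of_mk_eq h'
    obtain ⟨hij, hi⟩ := ho j rfl
    have hcontains : Contains w ((cs n).simple i * (cs n).simple j * (cs n).simple i) := by
      refine ⟨_, [i, j, i], hr, ?_, ⟨α, β, rfl⟩⟩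
      have := hr.factor
      simpa only [CoxeterSystem.wordProd_cons, CoxeterSystem.wordProd_nil, mul_one,
        mul_assoc] using this
    have h₀ := val_vtx (Nat.zero_le n)
    have h₁ := val_vtx hn
    have h₂ := val_vtx (Nat.sub_le n 1)
    have h₃ := val_vtx (le_refl n)
    unfold Allowed at hi
    by_cases hj₀ : j.val = 0
    · have e₁ : i = vtx n 1 := Fin.ext (by omega)
      have e₂ : j = vtx n 0 := Fin.ext (by omega)
      rw [e₁, e₂] at hcontains
      exact hw.1.2 hcontains
    by_cases hjn : j.val = n
    · have e₁ : i = vtx n (n - 1) := Fin.ext (by omega)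
      have e₂ : j = vtx n n := Fin.ext (by omega)
      rw [e₁, e₂] at hcontains
      exact hw.2.2 hcontains
    have hM : affineC n i j = 3 := by
      rw [affineC_apply, if_neg (by rintro rfl; omega), if_pos hij, if_neg (by omega)]
    have hbraid : (cs n).wordProd [j, i, j] = (cs n).wordProd [i, j, i] := by
      have := (cs n).simple_mul_simple_pow i j
      rw [hM, pow_succ, pow_two] at this
      have := eq_inv_of_mul_eq_one_right
        (show ((cs n).simple i * (cs n).simple j * (cs n).simple i) *
          ((cs n).simple j * (cs n).simple i * (cs n).simple j) = 1 by
          simpa only [mul_assoc] using this)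
      simp only [mul_inv_rev, CoxeterSystem.inv_simple] at this
      simpa only [CoxeterSystem.wordProd_cons, CoxeterSystem.wordProd_nil, mul_one,
        mul_assoc] using this
    have hr' := hr.replace hbraid (by simp)
    -- Commutations preserve the multiset of letters, whereas the braid move changes the number of
    -- `i`'s.
    have := congrArg letters (mk_eq_mk.2 (hw.1.1 _ _ hr hr'))
    simp only [mk_append, letters_mul, letters_mk] at this
    have := congrArg (Multiset.count i) this
    have hne : ¬ j = i := by rintro rfl; omega
    simp [hne] at this

end Positive

/-! ### Linear independence and spanning -/

section Basis

variable {K : Type*} [Field K] {n : ℕ} {p : Params K}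

theorem b_eq_monomial {w : W n} (hw : w ∈ fullyCommutative n) {ω : List (Fin (n + 1))}
    (hω : IsReducedExpr w ω) : b n p w = monomial n p ω :=
  monomial_eq_of_commEquiv (hw _ _ (exists_reducedExpr w).choose_spec hω)

theorem linearIndependent_proj_b (hn : 1 ≤ n) (hp : p.κL = p.κR) :
    LinearIndependent K fun w : positive n => proj n p (b n p w.1) := by
  let ω : W n → List (Fin (n + 1)) := fun w => (exists_reducedExpr w).choose
  have hω : ∀ w, IsReducedExpr w (ω w) := fun w => (exists_reducedExpr w).choose_spec
  let ev : TwoBTL n p →ₗ[K] (Trace n →₀ K) :=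
    (LinearMap.applyₗ (Finsupp.single 1 1)).comp (traceRep hn hp).toLinearMap
  -- Evaluation at the empty trace sends the image of `b_w` to the basis vector of its irreducible
  -- trace, and that trace determines `w`.
  refine LinearIndependent.of_comp ev ?_
  have e : (ev ∘ fun w : positive n => proj n p (b n p w.1)) =
      (fun m : Trace n => Finsupp.single m (1 : K)) ∘ fun w : positive n => mk (ω w.1) := by
    funext w
    have h₁ : ev (proj n p (b n p w.1)) = normalForm p (mk (ω w.1)) := by
      rw [b, proj_monomial, genProd_mk]
      exact traceRep_prod_gen hn hp _
    exact h₁.trans (normalForm_of_not_reducible p (not_reducible_of_mem_positive hn w.2 (hω w.1)))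
  rw [e]
  refine (Finsupp.linearIndependent_single_one K (Trace n)).comp _ fun w w' h => Subtype.ext ?_
  rw [← (hω w.1).2, ← (hω w'.1).2]
  exact wordProd_eq_of_mk_eq h

/-- Words span the algebra. By induction on length, a reducible word is a multiple of a shorter one,
and an irreducible word is a reduced expression of a positive element. -/
theorem span_range_proj_b (hn : 1 ≤ n) :
    Submodule.span K (Set.range fun w : positive n => proj n p (b n p w.1)) = ⊤ := by
  have mem : ∀ m : Trace n, genProd p m ∈
      Submodule.span K (Set.range fun w : positive n => proj n p (b n p w.1)) := by
    intro m
    induction hL : len m using Nat.strong_induction_on generalizing m with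
    | _ L IH =>
      by_cases h : Reducible m
      · obtain ⟨⟨α, i, o, β⟩, ho, rfl⟩ := h
        have e : genProd p (α * (redex i o * β)) = coef p i o • genProd p (α * (g i * β)) := by
          simp only [genProd_mul, genProd_redex ho, genProd_g, smul_mul_assoc, mul_smul_comm]
        rw [e]
        exact Submodule.smul_mem _ _ (IH _ (hL ▸ Reducible.len_lt rfl) _ rfl)
      · obtain ⟨ω, rfl⟩ := mk_surjective m
        obtain ⟨h₁, h₂⟩ := isReducedExpr_and_isFullyCommutative hn h
        refine Submodule.subset_span ⟨⟨_, wordProd_mem_positive hn h⟩, ?_⟩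
        simp only [b_eq_monomial h₂ h₁, proj_monomial]
  rw [eq_top_iff]
  rintro a -
  obtain ⟨a, rfl⟩ := RingQuot.mkAlgHom_surjective K (TwoBTLRel n p) a
  have ha : a ∈ Algebra.adjoin K (Set.range (FreeAlgebra.ι K : Fin (n + 1) → _)) := by
    rw [FreeAlgebra.adjoin_range_ι]
    trivial
  rw [← Subalgebra.mem_toSubmodule, Algebra.adjoin_eq_span] at ha
  induction ha using Submodule.span_induction with
  | zero => simp
  | add x y _ _ hx hy =>
    rw [map_add]
    exact add_mem hx hy
  | smul c x _ hx =>
    rw [map_smul]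
    exact Submodule.smul_mem _ _ hx
  | mem x hx =>
    obtain ⟨l, hl, rfl⟩ := Submonoid.exists_list_of_mem_closure hx
    have : ∃ ω : List (Fin (n + 1)), l = ω.map (FreeAlgebra.ι K) := by
      induction l with
      | nil => exact ⟨[], rfl⟩
      | cons y l ih =>
        obtain ⟨ω, rfl⟩ := ih (fun z hz => hl z (List.mem_cons_of_mem _ hz))
          (Submonoid.list_prod_mem _ fun z hz =>
            Submonoid.subset_closure (hl z (List.mem_cons_of_mem _ hz)))
        obtain ⟨i, rfl⟩ := hl y List.mem_cons_self
        exact ⟨i :: ω, rfl⟩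
    obtain ⟨ω, rfl⟩ := this
    rw [map_list_prod, List.map_map]
    exact mem (mk ω)

end Basis

end TwoBoundary

theorem theoremA {K : Type*} [Field K] [IsAlgClosed K] (n : ℕ) (hn : 1 ≤ n)
    (q Q : K) (hq : q ≠ 0) (hQ : Q ≠ 0)
    (rq rQ : K) (hrq : rq ^ 2 = q) (hrQ : rQ ^ 2 = Q) :
    -- `b_w` does not depend on the reduced expression of a fully commutative `w`
    (∀ w ∈ TwoBoundary.fullyCommutative n, ∀ ω, TwoBoundary.IsReducedExpr w ω →
      TwoBoundary.b n (TwoBoundary.Params.special q Q rq rQ) w =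
        TwoBoundary.monomial n (TwoBoundary.Params.special q Q rq rQ) ω) ∧
    -- the images of the `b_w`, for `w` positive, form a basis
    LinearIndependent K (fun w : TwoBoundary.positive n =>
      TwoBoundary.proj n (TwoBoundary.Params.special q Q rq rQ)
        (TwoBoundary.b n (TwoBoundary.Params.special q Q rq rQ) w.1)) ∧
    Submodule.span K (Set.range (fun w : TwoBoundary.positive n =>
      TwoBoundary.proj n (TwoBoundary.Params.special q Q rq rQ)
        (TwoBoundary.b n (TwoBoundary.Params.special q Q rq rQ) w.1))) = ⊤ :=
  ⟨fun _ hw _ hω => TwoBoundary.b_eq_monomial hw hω,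
    TwoBoundary.linearIndependent_proj_b hn rfl, TwoBoundary.span_range_proj_b hn⟩
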